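/- Let $d,m\in\mathbb N$, $T>0$, $r_0>0$, $0<\beta,\delta\le 1$ and $$0<\alpha<\alpha_0:=\min\Big\{\tfrac12,\ \beta,\ \tfrac{\delta}{1+\delta}\Big\}.$$ For $a<b$ let $W_0^{\alpha,\infty}(a,b;\mathbb R^d)$ be the space of measurable $f:[a,b]\to\mathbb R^d$ with $$\sup_{t\in[a,b]}\Big(|f(t)|+\int_a^t\frac{|f(t)-f(s)|}{(t-s)^{\alpha+1}}\,ds\Big)<\infty ,$$ write $\|f\|_{\alpha,\infty}$ for this supremum when $[a,b]=[0,T]$, and let $C^{\lambda}(a,b;\mathbb R^d)$ be the space of $\lambda$-Hölder continuous functions on $[a,b]$. Let $g:[0,T]\to\mathbb R^m$ be measurable with $$\sup_{0<s<t<T}\Big(\frac{|g(t)-g(s)|}{(t-s)^{1-\alpha}}+\int_s^t\frac{|g(u)-g(s)|}{(u-s)^{2-\alpha}}\,du\Big)<\infty ,$$ i.e. $g\in W_T^{1-\alpha,\infty}(0,T;\mathbb R^m)$. Integrals with respect to $g$ are (componentwise) the generalized Stieltjes integrals of Zähle, $$\int_0^t f\,dg=(-1)^\alpha\int_0^t D_{0+}^{\alpha}f(s)\,D_{t-}^{1-\alpha}g_{t-}(s)\,ds,\qquad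 g_{t-}(s)=g(s)-g(t-),$$ where $D_{0+}^\alpha$ and $D_{t-}^{1-\alpha}$ are the Weyl fractional derivatives. Assume: (H1) $\sigma:[0,T]\times\mathbb R^d\to\mathbb R^{d\times m}$ is measurable, differentiable in $x$, and for every $N\ge0$ there is $M_N>0$ such that, for all $s,t\in[0,T]$ and each $i=1,\dots,d$: $|\sigma(t,x)-\sigma(t,y)|\le M_0|x-y|$ for all $x,y\in\mathbb R^d$; $|\partial_{x_i}\sigma(t,x)-\partial_{x_i}\sigma(t,y)|\le M_N|x-y|^\delta$ whenever $|x|,|y|\le N$; and $|\sigma(t,x)-\sigma(s,x)|+|\partial_{x_i}\sigma(t,x)-\partial_{x_i}\sigma(s,x)|\le M_0|t-s|^\beta$ for all $x\in\mathbb R^d$. (H2') $b:[0,T]\times\mathbb R^d\to\mathbb R^d$ is measurable, and there are $b_0\in L^{1/\alpha}(0,T)$ and, for every $N\ge0$, a constant $L_N>0$ such that, for all $t\in[0,T]$: $|b(t,x)-b(t,y)|\le L_N|x-y|$ whenever $|x|,|y|\le N$; and $|b(t,x)|\le L_0|x|+b_0(t)$ for all $x\in\mathbb R^d$. Let $\eta\in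 W_0^{\alpha,\infty}(-r_0,0;\mathbb R^d)\cap C^{1-\alpha}(-r_0,0;\mathbb R^d)$. For $0<r\le r_0$ let $x^r\in W_0^{\alpha,\infty}(-r,T;\mathbb R^d)$ be a solution of the delay equation $$x^r(t)=\eta(0)+\int_0^t b(s,x^r(s))\,ds+\int_0^t\sigma(s,x^r(s-r))\,dg_s,\quad t\in(0,T],\qquad x^r(t)=\eta(t),\quad t\in[-r,0],$$ and let $x\in W_0^{\alpha,\infty}(0,T;\mathbb R^d)$ be a solution of the equation without delay $$x(t)=\eta(0)+\int_0^t b(s,x(s))\,ds+\int_0^t\sigma(s,x(s))\,dg_s,\quad t\in[0,T].$$ Then $$\lim_{r\downarrow0}\|x-x^r\|_{\alpha,\infty}=0 .$$ -/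

import Mathlib

open Set Filter Topology MeasureTheory
open scoped ENNReal

noncomputable section

namespace DelayEq

/-- `f` is measurable as a function on the interval `[a,b]`. -/
def MeasOn {E : Type*} [MeasurableSpace E] (a b : ℝ) (f : ℝ → E) : Prop :=
  Measurable (fun t : Icc a b => f t)

/-- The norm `sup_{t ∈ [a,b]} ( |f(t)| + ∫_a^t |f(t)-f(s)| / (t-s)^{α+1} ds )`, with values in
`[0,∞]`. -/
def wNorm {E : Type*} [NormedAddCommGroup E] (α a b : ℝ) (f : ℝ → E) : ℝ≥0∞ :=
  ⨆ t ∈ Icc a b, (ENNReal.ofReal ‖f t‖ +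
    ∫⁻ s in Ioo a t, ENNReal.ofReal (‖f t - f s‖ / (t - s) ^ (α + 1)))

/-- The space `W_0^{α,∞}(a,b;E)`. -/
def MemW {E : Type*} [NormedAddCommGroup E] [MeasurableSpace E] (α a b : ℝ) (f : ℝ → E) : Prop :=
  MeasOn a b f ∧ wNorm α a b f < ∞

/-- The norm `sup_{t ∈ [a,b]} |f(t)| + sup_{a ≤ s < t ≤ b} |f(t)-f(s)| / (t-s)^l`, with values in
`[0,∞]`. -/
def holderNorm {E : Type*} [NormedAddCommGroup E] (l a b : ℝ) (f : ℝ → E) : ℝ≥0∞ :=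
  (⨆ t ∈ Icc a b, ENNReal.ofReal ‖f t‖) +
    ⨆ s ∈ Icc a b, ⨆ t ∈ Ioc s b, ENNReal.ofReal (‖f t - f s‖ / (t - s) ^ l)

/-- The space `C^l(a,b;E)` of `l`-Hölder continuous functions on `[a,b]`. -/
def MemHolder {E : Type*} [NormedAddCommGroup E] (l a b : ℝ) (f : ℝ → E) : Prop :=
  holderNorm l a b f < ∞

/-- The norm `sup_{0<s<t<T} ( |g(t)-g(s)| / (t-s)^{1-α} + ∫_s^t |g(u)-g(s)| / (u-s)^{2-α} du )`,
with values in `[0,∞]`. -/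
def wTNorm {E : Type*} [NormedAddCommGroup E] (α T : ℝ) (g : ℝ → E) : ℝ≥0∞ :=
  ⨆ s ∈ Ioo 0 T, ⨆ t ∈ Ioo s T, (ENNReal.ofReal (‖g t - g s‖ / (t - s) ^ (1 - α)) +
    ∫⁻ u in Ioo s t, ENNReal.ofReal (‖g u - g s‖ / (u - s) ^ (2 - α)))

/-- The space `W_T^{1-α,∞}(0,T;E)`. -/
def MemWT {E : Type*} [NormedAddCommGroup E] [MeasurableSpace E] (α T : ℝ) (g : ℝ → E) : Prop :=
  MeasOn 0 T g ∧ wTNorm α T g < ∞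

/-- The left-sided Weyl derivative `D_{a+}^γ f` at `x > a`. -/
def weylLeft (γ a : ℝ) (f : ℝ → ℝ) (x : ℝ) : ℝ :=
  (Real.Gamma (1 - γ))⁻¹ *
    (f x / (x - a) ^ γ + γ * ∫ y in a..x, (f x - f y) / (x - y) ^ (γ + 1))

/-- The right-sided Weyl derivative `D_{b-}^γ g` at `x < b`, without the conventional complex
factor `(-1)^γ`. -/
def weylRight (γ b : ℝ) (g : ℝ → ℝ) (x : ℝ) : ℝ :=
  (Real.Gamma (1 - γ))⁻¹ *
    (g x / (b - x) ^ γ + γ * ∫ y in x..b, (g x - g y) / (y - x) ^ (γ + 1))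

/-- The generalized (Zähle) Stieltjes integral
`∫_a^b f dg = (-1)^α ∫_a^b D_{a+}^α f(x) D_{b-}^{1-α} g_{b-}(x) dx`, where
`g_{b-}(x) = g(x) - g(b-)`. The minus sign is `(-1)^α (-1)^{1-α}`. -/
def stieltjes (α a b : ℝ) (f g : ℝ → ℝ) : ℝ :=
  -∫ x in a..b, weylLeft α a f x *
    weylRight (1 - α) b (fun u => g u - Function.leftLim g b) x

/-- The `ℝ^d`-valued integral `∫_0^t A(s) dg_s` of a `d × m` matrix-valued function against an
`ℝ^m`-valued function: its `i`-th component is `∑_j ∫_0^t A_{ij}(s) dg^j_s`. -/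
def vecStieltjes {d m : ℕ} (α t : ℝ) (A : ℝ → EuclideanSpace ℝ (Fin d × Fin m))
    (g : ℝ → EuclideanSpace ℝ (Fin m)) : EuclideanSpace ℝ (Fin d) :=
  WithLp.toLp 2 fun i => ∑ j, stieltjes α 0 t (fun s => A s (i, j)) (fun s => g s j)

/-- The partial derivative `∂_{x_i} σ(t,x)`. -/
def partialX {d m : ℕ} (σ : ℝ → EuclideanSpace ℝ (Fin d) → EuclideanSpace ℝ (Fin d × Fin m))
    (i : Fin d) (t : ℝ) (x : EuclideanSpace ℝ (Fin d)) : EuclideanSpace ℝ (Fin d × Fin m) :=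
  fderiv ℝ (σ t) x (EuclideanSpace.single i 1)

/-- The hypothesis on the diffusion coefficient `σ`, with exponents `β` and `δ`; `d × m` matrices
carry the Euclidean norm of their entries. -/
def HypH1 {d m : ℕ} (T β δ : ℝ)
    (σ : ℝ → EuclideanSpace ℝ (Fin d) → EuclideanSpace ℝ (Fin d × Fin m)) : Prop :=
  Measurable (fun p : Icc (0 : ℝ) T × EuclideanSpace ℝ (Fin d) => σ p.1 p.2) ∧
  (∀ t ∈ Icc 0 T, Differentiable ℝ (σ t)) ∧
  ∃ M : ℝ → ℝ, (∀ N, 0 ≤ N → 0 < M N) ∧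
    (∀ t ∈ Icc 0 T, ∀ x y, ‖σ t x - σ t y‖ ≤ M 0 * ‖x - y‖) ∧
    (∀ N, 0 ≤ N → ∀ t ∈ Icc 0 T, ∀ x y, ‖x‖ ≤ N → ‖y‖ ≤ N → ∀ i,
      ‖partialX σ i t x - partialX σ i t y‖ ≤ M N * ‖x - y‖ ^ δ) ∧
    (∀ t ∈ Icc 0 T, ∀ s ∈ Icc 0 T, ∀ x, ∀ i,
      ‖σ t x - σ s x‖ + ‖partialX σ i t x - partialX σ i s x‖ ≤ M 0 * |t - s| ^ β)

/-- The hypothesis on the drift coefficient `b`, with integrability exponent `ρ`. -/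
def HypH2' {d : ℕ} (T ρ : ℝ)
    (b : ℝ → EuclideanSpace ℝ (Fin d) → EuclideanSpace ℝ (Fin d)) : Prop :=
  Measurable (fun p : Icc (0 : ℝ) T × EuclideanSpace ℝ (Fin d) => b p.1 p.2) ∧
  ∃ (b₀ : ℝ → ℝ) (L : ℝ → ℝ),
    MemLp b₀ (ENNReal.ofReal ρ) (volume.restrict (Icc 0 T)) ∧
    (∀ N, 0 ≤ N → 0 < L N) ∧
    (∀ N, 0 ≤ N → ∀ t ∈ Icc 0 T, ∀ x y, ‖x‖ ≤ N → ‖y‖ ≤ N →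
      ‖b t x - b t y‖ ≤ L N * ‖x - y‖) ∧
    (∀ t ∈ Icc 0 T, ∀ x, ‖b t x‖ ≤ L 0 * ‖x‖ + b₀ t)

/-- `x ∈ W_0^{α,∞}(-r,T;ℝ^d)` solves the delay equation
`x(t) = η(0) + ∫_0^t b(s,x(s)) ds + ∫_0^t σ(s,x(s-r)) dg_s` for `t ∈ (0,T]`, and `x = η` on
`[-r,0]`. -/
def IsDelaySolution {d m : ℕ} (α T r : ℝ)
    (b : ℝ → EuclideanSpace ℝ (Fin d) → EuclideanSpace ℝ (Fin d))
    (σ : ℝ → EuclideanSpace ℝ (Fin d) → EuclideanSpace ℝ (Fin d × Fin m))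
    (g : ℝ → EuclideanSpace ℝ (Fin m)) (η x : ℝ → EuclideanSpace ℝ (Fin d)) : Prop :=
  MemW α (-r) T x ∧
  (∀ t ∈ Ioc 0 T, x t = η 0 + (∫ s in (0 : ℝ)..t, b s (x s)) +
    vecStieltjes α t (fun s => σ s (x (s - r))) g) ∧
  ∀ t ∈ Icc (-r) 0, x t = η t

/-- `x ∈ W_0^{α,∞}(0,T;ℝ^d)` solves the equation without delay
`x(t) = x₀ + ∫_0^t b(s,x(s)) ds + ∫_0^t σ(s,x(s)) dg_s` for `t ∈ [0,T]`. -/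
def IsSolution {d m : ℕ} (α T : ℝ)
    (b : ℝ → EuclideanSpace ℝ (Fin d) → EuclideanSpace ℝ (Fin d))
    (σ : ℝ → EuclideanSpace ℝ (Fin d) → EuclideanSpace ℝ (Fin d × Fin m))
    (g : ℝ → EuclideanSpace ℝ (Fin m)) (x₀ : EuclideanSpace ℝ (Fin d))
    (x : ℝ → EuclideanSpace ℝ (Fin d)) : Prop :=
  MemW α 0 T x ∧
  ∀ t ∈ Icc 0 T, x t = x₀ + (∫ s in (0 : ℝ)..t, b s (x s)) +
    vecStieltjes α t (fun s => σ s (x s)) g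

end DelayEq

end

/-!
Both equations have the form `z(t) = x₀ + ∫_0^t b(s,z(s)) ds + ∫_0^t σ(s,y(s)) dg_s`, with `y = z`
or with `y(s) = z(s-r)`. An increment of such a `z` is bounded by a `(1-α)`-Hölder term and a
singular potential of `|y(u)| + ∫_0^u |y(u)-y(s)| (u-s)^{-α-1} ds` and `|z(u)|`. Integrating this
bound once more yields a Gronwall inequality with the kernel `(t-u)^{-α} u^{-α}`, whose integral is of
order `t^{1-2α}`; as `α < 1/2`, a large exponential weight turns the corresponding integral operator
into a contraction.

Applied to `x^r`, whose delayed path is controlled by the running supremum, the inequality gives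
bounds in `W_0^{α,∞}` and in `C^{1-α}` that are uniform in `r`. The difference `x - x^r` is
compared through the path `x^r(· - r)`: the four-point estimate for `σ` on the Hölder paths `x` and
`x^r(· - r)` shows that the increments of `x - x^r` are controlled by `x - x^r` itself and by
`x^r - x^r(· - r)`; its singular integrals are those of `(t-s)^{(1-α)δ-α-1}`, whence the condition
`α < (1-α)δ`, that is, `α < δ/(1+δ)`. Splitting the Hölder exponent as
`1 - α = (1-α-θ) + θ` with `α < θ < 1 - α` makes `x^r - x^r(· - r)` of order `r^{1-α-θ}`
in `W_0^{α,∞}`, and the same Gronwall inequality finishes.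
-/

noncomputable section

namespace DelayEq

/-- The power `x ^ p` of a real number, as an extended nonnegative real. -/
def epow (x p : ℝ) : ℝ≥0∞ := ENNReal.ofReal (x ^ p)

section Epow

variable {x y p q : ℝ}

lemma epow_ne_top : epow x p ≠ ∞ := ENNReal.ofReal_ne_top

@[fun_prop]
lemma measurable_epow {X : Type*} [MeasurableSpace X] {f : X → ℝ} (hf : Measurable f) :
    Measurable fun x => epow (f x) p :=
  (hf.pow_const p).ennreal_ofReal

lemma epow_zero : epow x 0 = 1 := by simp [epow]

lemma epow_mul_epow (hx : 0 < x) : epow x p * epow x q = epow x (p + q) := by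
  rw [epow, epow, epow, ← ENNReal.ofReal_mul (Real.rpow_nonneg hx.le _), ← Real.rpow_add hx]

lemma epow_mul_epow_neg (hx : 0 < x) : epow x p * epow x (-p) = 1 := by
  rw [epow_mul_epow hx, add_neg_cancel, epow_zero]

lemma mul_epow_neg_le_iff {a b : ℝ≥0∞} (hx : 0 < x) :
    a * epow x (-p) ≤ b ↔ a ≤ b * epow x p := by
  rw [epow, epow, Real.rpow_neg hx.le, ENNReal.ofReal_inv_of_pos (Real.rpow_pos_of_pos hx p),
    ← div_eq_mul_inv,
    ENNReal.div_le_iff (by simpa using Real.rpow_pos_of_pos hx p) ENNReal.ofReal_ne_top]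

lemma epow_le_epow_of_nonpos (hx : 0 < x) (hxy : x ≤ y) (hp : p ≤ 0) : epow y p ≤ epow x p :=
  ENNReal.ofReal_le_ofReal (Real.rpow_le_rpow_of_nonpos hx hxy hp)

lemma epow_le_epow (hx : 0 ≤ x) (hxy : x ≤ y) (hp : 0 ≤ p) : epow x p ≤ epow y p :=
  ENNReal.ofReal_le_ofReal (Real.rpow_le_rpow hx hxy hp)

lemma epow_half (hx : 0 < x) : epow (x / 2) (-p) = epow 2 p * epow x (-p) := by
  rw [epow, epow, epow, ← ENNReal.ofReal_mul (by positivity), Real.div_rpow hx.le zero_le_two,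
    Real.rpow_neg zero_le_two]
  field_simp

lemma epow_rpow (hx : 0 ≤ x) (hq : 0 ≤ q) : epow x p ^ q = epow x (p * q) := by
  rw [epow, epow, ENNReal.ofReal_rpow_of_nonneg (Real.rpow_nonneg hx p) hq, Real.rpow_mul hx]

lemma ofReal_norm_div_rpow {E : Type*} [NormedAddCommGroup E] (v : E) (hx : 0 < x) :
    ENNReal.ofReal (‖v‖ / x ^ p) = ‖v‖ₑ * epow x (-p) := by
  rw [epow, ← ofReal_norm, ← ENNReal.ofReal_mul (norm_nonneg v), Real.rpow_neg hx.le,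
    div_eq_mul_inv]

lemma tendsto_epow_zero (hp : 0 < p) : Tendsto (fun x => epow x p) (𝓝[>] 0) (𝓝 0) := by
  have h : Tendsto (fun x : ℝ => x ^ p) (𝓝[>] 0) (𝓝 (0 ^ p)) :=
    (Real.continuousAt_rpow_const 0 p (Or.inr hp.le)).tendsto.mono_left nhdsWithin_le_nhds
  simpa [epow, Real.zero_rpow hp.ne'] using ENNReal.tendsto_ofReal h

end Epow

section PowerIntegrals

variable {a b c p q γ : ℝ}

lemma setLIntegral_Ioo_sub_left (f : ℝ → ℝ≥0∞) (a b c : ℝ) :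
    ∫⁻ s in Ioo a b, f (c - s) = ∫⁻ x in Ioo (c - b) (c - a), f x := by
  rw [← (Measure.measurePreserving_sub_left (volume : Measure ℝ) c).setLIntegral_comp_preimage_emb
    (MeasurableEquiv.subLeft c).measurableEmbedding f (Ioo (c - b) (c - a))]
  simp

lemma setLIntegral_Ioo_sub_right (f : ℝ → ℝ≥0∞) (a b c : ℝ) :
    ∫⁻ s in Ioo a b, f (s - c) = ∫⁻ x in Ioo (a - c) (b - c), f x := by
  rw [← (measurePreserving_sub_right (volume : Measure ℝ) c).setLIntegral_comp_preimage_emb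
    (MeasurableEquiv.subRight c).measurableEmbedding f (Ioo (a - c) (b - c))]
  simp

lemma setLIntegral_Ioo_ofReal {f : ℝ → ℝ} (hab : a ≤ b) (hi : IntervalIntegrable f volume a b)
    (hf : ∀ x ∈ Ioc a b, 0 ≤ f x) :
    ∫⁻ x in Ioo a b, ENNReal.ofReal (f x) = ENNReal.ofReal (∫ x in a..b, f x) := by
  rw [restrict_Ioo_eq_restrict_Ioc, ← ofReal_integral_eq_lintegral_ofReal hi.1
    ((ae_restrict_iff' measurableSet_Ioc).2 (ae_of_all _ hf)),
    ← intervalIntegral.integral_of_le hab]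

lemma setLIntegral_Ioo_zero_epow (hc : 0 ≤ c) (hp : p < 1) :
    ∫⁻ x in Ioo 0 c, epow x (-p) = ENNReal.ofReal (1 - p)⁻¹ * epow c (1 - p) := by
  unfold epow
  rw [setLIntegral_Ioo_ofReal hc (intervalIntegral.intervalIntegrable_rpow' (by linarith))
    fun x hx => Real.rpow_nonneg hx.1.le _, integral_rpow (Or.inl (by linarith)),
    ← ENNReal.ofReal_mul (inv_nonneg.2 (by linarith)), Real.zero_rpow (by linarith),
    neg_add_eq_sub, sub_zero, div_eq_inv_mul]

lemma setLIntegral_epow_sub_left (hab : a ≤ b) (hp : p < 1) :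
    ∫⁻ s in Ioo a b, epow (b - s) (-p) = ENNReal.ofReal (1 - p)⁻¹ * epow (b - a) (1 - p) := by
  rw [setLIntegral_Ioo_sub_left (fun x => epow x (-p)), sub_self,
    setLIntegral_Ioo_zero_epow (by linarith) hp]

lemma setLIntegral_epow_sub_right (hab : a ≤ b) (hp : p < 1) :
    ∫⁻ s in Ioo a b, epow (s - a) (-p) = ENNReal.ofReal (1 - p)⁻¹ * epow (b - a) (1 - p) := by
  rw [setLIntegral_Ioo_sub_right (fun x => epow x (-p)), sub_self,
    setLIntegral_Ioo_zero_epow (by linarith) hp]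

lemma setLIntegral_epow_tail_le (ha : 0 < a) (hγ : 0 < γ) :
    ∫⁻ x in Ioo a c, epow x (-(γ + 1)) ≤ ENNReal.ofReal γ⁻¹ * epow a (-γ) := by
  rcases lt_or_ge c a with hac | hac
  · simp [Ioo_eq_empty (not_lt.2 hac.le)]
  have h0 : (0 : ℝ) ∉ uIcc a c := by
    rw [uIcc_of_le hac]
    exact fun h => ha.not_ge h.1
  have hc : 0 ≤ c ^ (-γ) := Real.rpow_nonneg (ha.le.trans hac) _
  unfold epow
  rw [setLIntegral_Ioo_ofReal hac (intervalIntegral.intervalIntegrable_rpow (Or.inr h0))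
    fun x hx => Real.rpow_nonneg (ha.trans hx.1).le _,
    integral_rpow (Or.inr ⟨by linarith, h0⟩), ← ENNReal.ofReal_mul (inv_nonneg.2 hγ.le),
    neg_add, neg_add_cancel_right, div_neg, ← neg_div, div_eq_inv_mul]
  gcongr
  linarith

lemma setLIntegral_epow_tail_left_le (hbc : b < c) (hγ : 0 < γ) :
    ∫⁻ s in Ioo a b, epow (c - s) (-(γ + 1)) ≤ ENNReal.ofReal γ⁻¹ * epow (c - b) (-γ) := by
  rw [setLIntegral_Ioo_sub_left (fun x => epow x (-(γ + 1)))]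
  exact setLIntegral_epow_tail_le (by linarith) hγ

lemma setLIntegral_epow_tail_right_le (hca : c < a) (hγ : 0 < γ) :
    ∫⁻ s in Ioo a b, epow (s - c) (-(γ + 1)) ≤ ENNReal.ofReal γ⁻¹ * epow (a - c) (-γ) := by
  rw [setLIntegral_Ioo_sub_right (fun x => epow x (-(γ + 1)))]
  exact setLIntegral_epow_tail_le (by linarith) hγ

/-- An upper bound for the Beta integral `∫_0^1 (1-s)^{-p} s^{-q} ds` with `p, q < 1`, obtained by
splitting it at the midpoint. -/
def betaBound (p q : ℝ) : ℝ≥0∞ :=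
  epow 2 p * ENNReal.ofReal (1 - q)⁻¹ + epow 2 q * ENNReal.ofReal (1 - p)⁻¹

lemma betaBound_ne_top : betaBound p q ≠ ∞ := by
  unfold betaBound epow
  finiteness

lemma setLIntegral_beta_le (hab : a < b) (hp : 0 ≤ p) (hp1 : p < 1) (hq : 0 ≤ q) (hq1 : q < 1) :
    ∫⁻ s in Ioo a b, epow (b - s) (-p) * epow (s - a) (-q) ≤
      betaBound p q * epow (b - a) (1 - p - q) := by
  have hba : 0 < b - a := sub_pos.2 hab
  have hsplit : ∀ s, epow (b - s) (-p) * epow (s - a) (-q) ≤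
      epow ((b - a) / 2) (-p) * epow (s - a) (-q) +
        epow ((b - a) / 2) (-q) * epow (b - s) (-p) := by
    intro s
    rcases le_total s ((a + b) / 2) with h | h
    · refine le_trans ?_ le_self_add
      gcongr
      exact epow_le_epow_of_nonpos (by linarith) (by linarith) (by linarith)
    · rw [mul_comm]
      refine le_trans ?_ le_add_self
      gcongr
      exact epow_le_epow_of_nonpos (by linarith) (by linarith) (by linarith)
  have hp' : epow (b - a) (1 - p - q) = epow (b - a) (-p) * epow (b - a) (1 - q) := by
    rw [epow_mul_epow hba]; ring_nf
  have hq' : epow (b - a) (1 - p - q) = epow (b - a) (-q) * epow (b - a) (1 - p) := by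
    rw [epow_mul_epow hba]; ring_nf
  refine (lintegral_mono hsplit).trans (le_of_eq ?_)
  rw [lintegral_add_left (by fun_prop), lintegral_const_mul _ (by fun_prop),
    lintegral_const_mul _ (by fun_prop), setLIntegral_epow_sub_left hab.le hp1,
    setLIntegral_epow_sub_right hab.le hq1, epow_half hba, epow_half hba, betaBound, add_mul]
  nth_rewrite 1 [hp']
  rw [hq']
  ring

end PowerIntegrals

section Gronwall

variable {α l t T : ℝ}

/-- The exponential as an extended nonnegative real. -/
def eexp (x : ℝ) : ℝ≥0∞ := ENNReal.ofReal (Real.exp x)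

lemma eexp_ne_top {x : ℝ} : eexp x ≠ ∞ := ENNReal.ofReal_ne_top

@[fun_prop]
lemma measurable_eexp : Measurable eexp := Real.measurable_exp.ennreal_ofReal

lemma eexp_le_eexp {x y : ℝ} (h : x ≤ y) : eexp x ≤ eexp y :=
  ENNReal.ofReal_le_ofReal (Real.exp_le_exp.2 h)

lemma eexp_zero : eexp 0 = 1 := by simp [eexp]

lemma eexp_mul_eexp (x y : ℝ) : eexp x * eexp y = eexp (x + y) := by
  rw [eexp, eexp, eexp, ← ENNReal.ofReal_mul (Real.exp_nonneg _), Real.exp_add]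

lemma eexp_neg_le_epow {x p : ℝ} (hx : 0 < x) (hp : 0 ≤ p) (hp1 : p ≤ 1) :
    eexp (-x) ≤ epow x (-p) := by
  refine ENNReal.ofReal_le_ofReal ?_
  rw [Real.exp_neg, Real.rpow_neg hx.le]
  apply inv_anti₀ (Real.rpow_pos_of_pos hx p)
  calc x ^ p ≤ (Real.exp x) ^ p :=
        Real.rpow_le_rpow hx.le ((lt_add_one x).le.trans (Real.add_one_le_exp x)) hp
    _ = Real.exp (x * p) := (Real.exp_mul x p).symm
    _ ≤ Real.exp x := Real.exp_le_exp.2 (by nlinarith)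

lemma le_two_mul_of_le_add_half {S a : ℝ≥0∞} (hS : S ≠ ∞) (h : S ≤ a + S / 2) : S ≤ 2 * a := by
  have ha : S / 2 ≤ a := by
    rw [← ENNReal.add_le_add_iff_right (ENNReal.div_ne_top hS two_ne_zero), ENNReal.add_halves]
    exact h
  calc S = S / 2 + S / 2 := (ENNReal.add_halves S).symm
    _ ≤ a + a := add_le_add ha ha
    _ = 2 * a := (two_mul a).symm

lemma lintegral_mul_iSup_le_of_discounted {k : ℝ → ℝ≥0∞} {φ : ℝ → ℝ≥0∞} {S : ℝ≥0∞}
    (hl : 0 ≤ l) (hk : Measurable k)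
    (hkl : ∫⁻ u in Ioo 0 t, k u * eexp (-(l * (t - u))) ≤ 1 / 2)
    (hφ : ∀ v ∈ Icc 0 t, φ v ≤ eexp (l * v) * S) :
    ∫⁻ u in Ioo 0 t, k u * ⨆ v ∈ Icc 0 u, φ v ≤ eexp (l * t) * (S / 2) := by
  have hsup : ∀ u ∈ Ioo 0 t, ⨆ v ∈ Icc 0 u, φ v ≤ eexp (l * u) * S := fun u hu =>
    iSup₂_le fun v hv => (hφ v ⟨hv.1, hv.2.trans hu.2.le⟩).trans
      (mul_le_mul_left (eexp_le_eexp (mul_le_mul_of_nonneg_left hv.2 hl)) S)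
  calc _ ≤ ∫⁻ u in Ioo 0 t, eexp (l * t) * (k u * eexp (-(l * (t - u))) * S) := by
        refine setLIntegral_mono (by fun_prop) fun u hu => ?_
        calc _ ≤ k u * (eexp (l * u) * S) := by gcongr; exact hsup u hu
          _ = k u * (eexp (l * t) * eexp (-(l * (t - u))) * S) := by
            rw [eexp_mul_eexp]; ring_nf
          _ = _ := by ring
    _ = eexp (l * t) * ((∫⁻ u in Ioo 0 t, k u * eexp (-(l * (t - u)))) * S) := by
        rw [lintegral_const_mul _ (by fun_prop), lintegral_mul_const _ (by fun_prop)]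
    _ ≤ eexp (l * t) * (1 / 2 * S) := by gcongr
    _ = _ := by rw [one_div, mul_comm 2⁻¹, div_eq_mul_inv]

lemma gronwall_of_discounted {k : ℝ → ℝ → ℝ≥0∞} {φ : ℝ → ℝ≥0∞} {a : ℝ≥0∞} (hl : 0 ≤ l)
    (hk : ∀ t, Measurable (k t))
    (hkl : ∀ t ∈ Icc 0 T, ∫⁻ u in Ioo 0 t, k t u * eexp (-(l * (t - u))) ≤ 1 / 2)
    (hφ : (⨆ t ∈ Icc 0 T, φ t) ≠ ∞)
    (h : ∀ t ∈ Icc 0 T, φ t ≤ a + ∫⁻ u in Ioo 0 t, k t u * ⨆ v ∈ Icc 0 u, φ v) :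
    ∀ t ∈ Icc 0 T, φ t ≤ eexp (l * T) * 2 * a := by
  set S := ⨆ t ∈ Icc 0 T, eexp (-(l * t)) * φ t
  have hdisc : ∀ t ∈ Icc 0 T, eexp (-(l * t)) ≤ 1 := fun t ht =>
    eexp_zero ▸ eexp_le_eexp (by nlinarith [ht.1])
  have hφS : ∀ t ∈ Icc 0 T, φ t ≤ eexp (l * t) * S := fun t ht => calc
    φ t = eexp (l * t) * (eexp (-(l * t)) * φ t) := by
          rw [← mul_assoc, eexp_mul_eexp, add_neg_cancel, eexp_zero, one_mul]
    _ ≤ eexp (l * t) * S := by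
          gcongr
          exact le_iSup₂ (f := fun t (_ : t ∈ Icc 0 T) => eexp (-(l * t)) * φ t) t ht
  have hS : S ≠ ∞ := ne_top_of_le_ne_top hφ
    (iSup₂_mono fun t ht => mul_le_of_le_one_left' (hdisc t ht))
  have hSle : S ≤ a + S / 2 := iSup₂_le fun t ht => calc
    eexp (-(l * t)) * φ t ≤ eexp (-(l * t)) * (a + eexp (l * t) * (S / 2)) := by
          gcongr
          refine (h t ht).trans ?_
          gcongr
          exact lintegral_mul_iSup_le_of_discounted hl (hk t) (hkl t ht)
            fun v hv => hφS v ⟨hv.1, hv.2.trans ht.2⟩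
    _ = eexp (-(l * t)) * a + S / 2 := by
          rw [mul_add, ← mul_assoc, eexp_mul_eexp, neg_add_cancel, eexp_zero, one_mul]
    _ ≤ a + S / 2 := by
          gcongr
          exact mul_le_of_le_one_left' (hdisc t ht)
  intro t ht
  calc φ t ≤ eexp (l * t) * S := hφS t ht
    _ ≤ eexp (l * T) * (2 * a) :=
        mul_le_mul' (eexp_le_eexp (mul_le_mul_of_nonneg_left ht.2 hl))
          (le_two_mul_of_le_add_half hS hSle)
    _ = _ := (mul_assoc _ _ _).symm

/-- The singular kernel `(t-u)^{-α} u^{-α}`. -/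
def kernel (α t u : ℝ) : ℝ≥0∞ := epow (t - u) (-α) * epow u (-α)

@[fun_prop]
lemma measurable_kernel : Measurable (kernel α t) := by
  unfold kernel
  fun_prop

lemma lintegral_kernel_mul_eexp_le (hα : 0 < α) (hα' : α < 1 / 2) (ht : 0 < t) (hl : 0 < l) :
    ∫⁻ u in Ioo 0 t, kernel α t u * eexp (-(l * (t - u))) ≤
      epow l (-(1 / 2 - α)) * (betaBound (1 / 2) α * epow t (1 / 2 - α)) := by
  have hexp : ∀ u ∈ Ioo 0 t, kernel α t u * eexp (-(l * (t - u))) ≤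
      epow l (-(1 / 2 - α)) * (epow (t - u) (-(1 / 2)) * epow (u - 0) (-α)) := by
    intro u hu
    have htu : 0 < t - u := sub_pos.2 hu.2
    calc _ ≤ kernel α t u * epow (l * (t - u)) (-(1 / 2 - α)) := by
          gcongr
          exact eexp_neg_le_epow (by positivity) (by linarith) (by linarith)
      _ = kernel α t u * (epow l (-(1 / 2 - α)) * epow (t - u) (-(1 / 2 - α))) := by
          rw [epow, Real.mul_rpow hl.le htu.le, ENNReal.ofReal_mul (by positivity), epow, epow]
      _ = epow l (-(1 / 2 - α)) * (epow (t - u) (-α) * epow (t - u) (-(1 / 2 - α)) *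
            epow u (-α)) := by rw [kernel]; ring
      _ = _ := by rw [epow_mul_epow htu, sub_zero]; ring_nf
  refine (setLIntegral_mono (by fun_prop) hexp).trans ?_
  rw [lintegral_const_mul _ (by fun_prop)]
  gcongr
  refine (setLIntegral_beta_le ht (by norm_num) (by norm_num) hα.le (by linarith)).trans_eq ?_
  rw [sub_zero]
  norm_num

lemma exists_lintegral_kernel_mul_eexp_le (hα : 0 < α) (hα' : α < 1 / 2) (T : ℝ) {C : ℝ≥0∞}
    (hC : C ≠ ∞) :
    ∃ l : ℝ, 0 < l ∧ ∀ t ∈ Icc 0 T,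
      ∫⁻ u in Ioo 0 t, C * kernel α t u * eexp (-(l * (t - u))) ≤ 1 / 2 := by
  set B := C * (betaBound (1 / 2) α * epow T (1 / 2 - α))
  have hB : B ≠ ∞ := ENNReal.mul_ne_top hC (ENNReal.mul_ne_top betaBound_ne_top epow_ne_top)
  have hlim : Tendsto (fun l : ℝ => B * epow l (-(1 / 2 - α))) atTop (𝓝 0) := by
    have h := ENNReal.tendsto_ofReal (tendsto_rpow_neg_atTop (sub_pos.2 hα'))
    rw [ENNReal.ofReal_zero] at h
    simpa only [epow, mul_zero] using ENNReal.Tendsto.const_mul h (Or.inr hB)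
  obtain ⟨l, hl, hl0⟩ := ((hlim.eventually (ge_mem_nhds (show (0 : ℝ≥0∞) < 1 / 2 by simp))).and
    (eventually_gt_atTop (0 : ℝ))).exists
  refine ⟨l, hl0, fun t ht => ?_⟩
  rcases ht.1.eq_or_lt with rfl | ht0
  · simp
  simp_rw [mul_assoc]
  calc _ = C * ∫⁻ u in Ioo 0 t, kernel α t u * eexp (-(l * (t - u))) :=
        lintegral_const_mul _ (by fun_prop)
    _ ≤ C * (epow l (-(1 / 2 - α)) * (betaBound (1 / 2) α * epow T (1 / 2 - α))) := by
        gcongr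
        refine (lintegral_kernel_mul_eexp_le hα hα' ht0 hl0).trans ?_
        gcongr
        exact epow_le_epow ht0.le ht.2 (by linarith)
    _ = B * epow l (-(1 / 2 - α)) := by ring
    _ ≤ 1 / 2 := hl

lemma exists_gronwall_kernel (hα : 0 < α) (hα' : α < 1 / 2) (T : ℝ) {C : ℝ≥0∞} (hC : C ≠ ∞) :
    ∃ K : ℝ≥0∞, K ≠ ∞ ∧ ∀ (φ : ℝ → ℝ≥0∞) (a : ℝ≥0∞), (⨆ t ∈ Icc 0 T, φ t) ≠ ∞ →
      (∀ t ∈ Icc 0 T, φ t ≤ a + C * ∫⁻ u in Ioo 0 t, kernel α t u * ⨆ v ∈ Icc 0 u, φ v) →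
      ∀ t ∈ Icc 0 T, φ t ≤ K * a := by
  obtain ⟨l, hl, hkl⟩ := exists_lintegral_kernel_mul_eexp_le hα hα' T hC
  refine ⟨eexp (l * T) * 2, ENNReal.mul_ne_top eexp_ne_top ENNReal.ofNat_ne_top,
    fun φ a hφ h => gronwall_of_discounted hl.le (fun t => by fun_prop) hkl hφ fun t ht => ?_⟩
  refine (h t ht).trans_eq ?_
  simp_rw [mul_assoc]
  rw [lintegral_const_mul' _ _ hC]

end Gronwall

section Measurability

variable {E : Type*} [MeasurableSpace E] {a b : ℝ}

lemma measurable_setLIntegral_Ioo {f : ℝ → ℝ → ℝ≥0∞} (hf : Measurable (Function.uncurry f))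
    {l r : ℝ → ℝ} (hl : Measurable l) (hr : Measurable r) :
    Measurable fun s => ∫⁻ u in Ioo (l s) (r s), f s u := by
  have hset : MeasurableSet {p : ℝ × ℝ | l p.1 < p.2 ∧ p.2 < r p.1} :=
    (measurableSet_lt (hl.comp measurable_fst) measurable_snd).inter
      (measurableSet_lt measurable_snd (hr.comp measurable_fst))
  convert Measurable.lintegral_prod_right' (ν := volume) (hf.indicator hset) using 2 with s
  rw [← lintegral_indicator measurableSet_Ioo]
  rfl

lemma setLIntegral_Ioo_swap {f : ℝ → ℝ → ℝ≥0∞} (hf : Measurable (Function.uncurry f)) (a t : ℝ) :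
    ∫⁻ s in Ioo a t, ∫⁻ u in Ioo s t, f s u = ∫⁻ u in Ioo a t, ∫⁻ s in Ioo a u, f s u := by
  have hset : MeasurableSet {p : ℝ × ℝ | p.1 < p.2} :=
    measurableSet_lt measurable_fst measurable_snd
  calc _ = ∫⁻ s in Ioo a t, ∫⁻ u in Ioo a t,
        {p : ℝ × ℝ | p.1 < p.2}.indicator (Function.uncurry f) (s, u) := by
        refine setLIntegral_congr_fun measurableSet_Ioo fun s hs => ?_
        have h : Ioo s t = Ioi s ∩ Ioo a t := by grind
        simp only [h]
        rw [← setLIntegral_indicator measurableSet_Ioi]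
        rfl
    _ = ∫⁻ u in Ioo a t, ∫⁻ s in Ioo a t,
        {p : ℝ × ℝ | p.1 < p.2}.indicator (Function.uncurry f) (s, u) :=
        lintegral_lintegral_swap (hf.indicator hset).aemeasurable
    _ = _ := by
        refine setLIntegral_congr_fun measurableSet_Ioo fun u hu => ?_
        have h : Ioo a u = Iio u ∩ Ioo a t := by grind
        simp only [h]
        rw [← setLIntegral_indicator measurableSet_Iio]
        rfl

lemma MeasOn.measurable_indicator [Zero E] {f : ℝ → E} (hf : MeasOn a b f) :
    Measurable ((Icc a b).indicator f) := by
  refine measurable_of_restrict_of_restrict_compl (measurableSet_Icc (a := a) (b := b)) ?_ ?_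
  · refine (congrArg Measurable (funext fun t => ?_)).mpr hf
    exact indicator_of_mem t.2 f
  · refine (congrArg Measurable (funext fun t => ?_)).mpr (measurable_const (a := (0 : E)))
    exact indicator_of_notMem t.2 f

lemma MeasOn.congr {f f' : ℝ → E} (hf : MeasOn a b f) (h : EqOn f f' (Icc a b)) :
    MeasOn a b f' := by
  have : (fun t : Icc a b => f' t) = fun t : Icc a b => f t := funext fun t => (h t.2).symm
  rw [MeasOn, this]
  exact hf

lemma measOn_of_measurable {f : ℝ → E} (hf : Measurable f) : MeasOn a b f :=
  hf.comp measurable_subtype_coe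

lemma MeasOn.mono {a' b' : ℝ} {f : ℝ → E} (hf : MeasOn a b f) (ha : a ≤ a') (hb : b' ≤ b) :
    MeasOn a' b' f :=
  Measurable.comp (g := fun t : Icc a b => f t) hf (measurable_inclusion (Icc_subset_Icc ha hb))

lemma MeasOn.aestronglyMeasurable {F : Type*} [NormedAddCommGroup F] [SecondCountableTopology F]
    [MeasurableSpace F] [BorelSpace F] {a' b' : ℝ} {f : ℝ → F} (hf : MeasOn a b f) (ha : a ≤ a')
    (hb : b' ≤ b) : AEStronglyMeasurable f (volume.restrict (Ioo a' b')) := by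
  refine hf.measurable_indicator.aestronglyMeasurable.congr ?_
  refine (ae_restrict_iff' measurableSet_Ioo).2 (ae_of_all _ fun u hu => ?_)
  exact indicator_of_mem (show u ∈ Icc a b from ⟨ha.trans hu.1.le, hu.2.le.trans hb⟩) f

end Measurability

section Seminorm

variable {E : Type*} [NormedAddCommGroup E] {α a b t : ℝ} {f f' : ℝ → E}

/-- The singular integral `∫_a^t |f(t)-f(s)| (t-s)^{-α-1} ds`. -/
def incInt (α a : ℝ) (f : ℝ → E) (t : ℝ) : ℝ≥0∞ :=
  ∫⁻ s in Ioo a t, ‖f t - f s‖ₑ * epow (t - s) (-(α + 1))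

/-- The expression `|f(t)| + ∫_a^t |f(t)-f(s)| (t-s)^{-α-1} ds` whose supremum over `t` is the norm
of `W_0^{α,∞}`. -/
def wPt (α a : ℝ) (f : ℝ → E) (t : ℝ) : ℝ≥0∞ := ‖f t‖ₑ + incInt α a f t

lemma wNorm_eq_iSup_wPt : wNorm α a b f = ⨆ t ∈ Icc a b, wPt α a f t := by
  refine iSup_congr fun t => iSup_congr fun _ => ?_
  rw [wPt, incInt, ofReal_norm]
  congr 1
  exact setLIntegral_congr_fun measurableSet_Ioo fun s hs => ofReal_norm_div_rpow _ (sub_pos.2 hs.2)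

lemma wPt_le_wNorm (ht : t ∈ Icc a b) : wPt α a f t ≤ wNorm α a b f := by
  rw [wNorm_eq_iSup_wPt]
  exact le_iSup₂ (f := fun t _ => wPt α a f t) t ht

lemma enorm_le_wPt : ‖f t‖ₑ ≤ wPt α a f t := le_self_add

lemma incInt_le_wPt : incInt α a f t ≤ wPt α a f t := le_add_self

lemma incInt_congr (h : EqOn f f' (Ioc a t)) : incInt α a f t = incInt α a f' t := by
  refine setLIntegral_congr_fun measurableSet_Ioo fun s hs => ?_
  rw [h (Ioo_subset_Ioc_self hs), h ⟨hs.1.trans hs.2, le_rfl⟩]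

lemma measurable_incInt [MeasurableSpace E] [BorelSpace E] [SecondCountableTopology E]
    (hf : Measurable f) : Measurable (incInt α a f) := by
  refine measurable_setLIntegral_Ioo ?_ measurable_const measurable_id
  unfold Function.uncurry
  fun_prop

lemma MeasOn.wPt [MeasurableSpace E] [BorelSpace E] [SecondCountableTopology E]
    (hf : MeasOn a b f) : MeasOn a b (wPt α a f) := by
  have hF := hf.measurable_indicator
  refine (measOn_of_measurable (hF.enorm.add (measurable_incInt (α := α) (a := a) hF))).congr ?_
  intro t ht
  have h : EqOn ((Icc a b).indicator f) f (Icc a b) := fun s hs => indicator_of_mem hs f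
  rw [DelayEq.wPt, Pi.add_apply, h ht,
    incInt_congr (h.mono (Ioc_subset_Icc_self.trans (Icc_subset_Icc_right ht.2)))]

lemma incInt_add_le [MeasurableSpace E] [BorelSpace E] [SecondCountableTopology E]
    (hf : MeasOn a b f) (ht : t ∈ Icc a b) :
    incInt α a (fun s => f s + f' s) t ≤ incInt α a f t + incInt α a f' t := by
  have h : EqOn ((Icc a b).indicator f) f (Icc a b) := fun s hs => indicator_of_mem hs f
  have hF := hf.measurable_indicator
  rw [incInt_congr ((h.mono (Ioc_subset_Icc_self.trans (Icc_subset_Icc_right ht.2))).symm)]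
  unfold incInt
  rw [← lintegral_add_left (by fun_prop)]
  refine setLIntegral_mono' measurableSet_Ioo fun s hs => ?_
  rw [← add_mul, h ht, h ⟨hs.1.le, hs.2.le.trans ht.2⟩, add_sub_add_comm]
  gcongr
  exact enorm_add_le _ _

lemma wPt_add_le [MeasurableSpace E] [BorelSpace E] [SecondCountableTopology E]
    (hf : MeasOn a b f) (ht : t ∈ Icc a b) :
    wPt α a (fun s => f s + f' s) t ≤ wPt α a f t + wPt α a f' t := calc
  _ ≤ ‖f t‖ₑ + ‖f' t‖ₑ + (incInt α a f t + incInt α a f' t) :=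
      add_le_add (enorm_add_le _ _) (incInt_add_le hf ht)
  _ = _ := add_add_add_comm _ _ _ _

lemma wPt_le_of_enorm_sub_le {F : Type*} [NormedAddCommGroup F] {g : ℝ → F} {m : ℝ≥0∞}
    {ω : ℝ → ℝ≥0∞} (hm : m ≠ ∞) (hω : Measurable ω)
    (h : ∀ s ∈ Ioo a t, ‖f t - f s‖ₑ ≤ m * ‖g t - g s‖ₑ + ω (t - s)) :
    wPt α a f t ≤
      ‖f t‖ₑ + (m * incInt α a g t + ∫⁻ s in Ioo a t, ω (t - s) * epow (t - s) (-(α + 1))) := by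
  unfold wPt incInt
  gcongr ‖f t‖ₑ + ?_
  rw [← lintegral_const_mul' _ _ hm, ← lintegral_add_right _ (by fun_prop)]
  refine setLIntegral_mono' measurableSet_Ioo fun s hs => ?_
  rw [← mul_assoc, ← add_mul]
  gcongr
  exact h s hs

end Seminorm

section Potential

variable {α s t : ℝ} {K : ℝ≥0∞} {Ψ Ψ' : ℝ → ℝ≥0∞}

/-- The singular potential of `Ψ` that controls the increment over `[s,t]` of an integral with
respect to a `(1-α)`-Hölder integrator. -/
def potential (α s t : ℝ) (Ψ : ℝ → ℝ≥0∞) : ℝ≥0∞ :=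
  (∫⁻ u in Ioo s t, epow u (-α) * Ψ u) +
    epow (t - s) (1 - α) * ∫⁻ u in Ioo 0 s, epow (s - u) (-(1 - α)) * epow u (-α) * Ψ u

lemma potential_le_mul (hK : K ≠ ∞) (hs : 0 ≤ s) (hst : s ≤ t)
    (h : ∀ u ∈ Icc 0 t, Ψ u ≤ K * Ψ' u) : potential α s t Ψ ≤ K * potential α s t Ψ' := by
  unfold potential
  rw [mul_add, mul_left_comm, ← lintegral_const_mul' _ _ hK, ← lintegral_const_mul' _ _ hK]
  gcongr ?_ + _ * ?_
  · refine setLIntegral_mono' measurableSet_Ioo fun u hu => ?_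
    rw [mul_left_comm]
    gcongr
    exact h u ⟨hs.trans hu.1.le, hu.2.le⟩
  · refine setLIntegral_mono' measurableSet_Ioo fun u hu => ?_
    rw [mul_left_comm]
    gcongr
    exact h u ⟨hu.1.le, hu.2.le.trans hst⟩

lemma lintegral_epow_le_potential : ∫⁻ u in Ioo s t, epow u (-α) * Ψ u ≤ potential α s t Ψ :=
  le_self_add

lemma potential_zero_left : potential α 0 t Ψ = ∫⁻ u in Ioo 0 t, epow u (-α) * Ψ u := by
  simp [potential]

lemma potential_one_le (hα : 0 < α) (hα' : α < 1) (hs : 0 ≤ s) (hst : s < t) :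
    potential α s t 1 ≤
      (ENNReal.ofReal (1 - α)⁻¹ + betaBound (1 - α) α) * epow (t - s) (1 - α) := by
  unfold potential
  simp only [Pi.one_apply, mul_one]
  have hright : ∫⁻ u in Ioo s t, epow u (-α) ≤ ENNReal.ofReal (1 - α)⁻¹ * epow (t - s) (1 - α) := by
    rw [← setLIntegral_epow_sub_right hst.le hα']
    refine setLIntegral_mono (by fun_prop) fun u hu => ?_
    exact epow_le_epow_of_nonpos (by linarith [hu.1]) (by linarith) (by linarith)
  have hleft : ∫⁻ u in Ioo 0 s, epow (s - u) (-(1 - α)) * epow u (-α) ≤ betaBound (1 - α) α := by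
    rcases hs.eq_or_lt with rfl | hs
    · simp
    simpa [epow_zero] using setLIntegral_beta_le hs (p := 1 - α) (q := α) (by linarith)
      (by linarith) hα.le hα'
  rw [add_mul, mul_comm (betaBound _ _)]
  gcongr

lemma setLIntegral_setLIntegral_tail_le (hα : 0 < α) (hΨ : Measurable Ψ) :
    ∫⁻ s in Ioo 0 t, (∫⁻ u in Ioo s t, Ψ u) * epow (t - s) (-(α + 1)) ≤
      ENNReal.ofReal α⁻¹ * ∫⁻ u in Ioo 0 t, epow (t - u) (-α) * Ψ u := by
  have hmeas : Measurable (Function.uncurry fun s u => Ψ u * epow (t - s) (-(α + 1))) := by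
    unfold Function.uncurry
    fun_prop
  simp_rw [← lintegral_mul_const _ hΨ]
  rw [setLIntegral_Ioo_swap hmeas, ← lintegral_const_mul _ (by fun_prop)]
  refine setLIntegral_mono (by fun_prop) fun u hu => ?_
  rw [lintegral_const_mul _ (by fun_prop), mul_comm, ← mul_assoc]
  gcongr
  exact setLIntegral_epow_tail_left_le hu.2 hα

lemma setLIntegral_setLIntegral_beta_le (hα : 0 < α) (hα' : α < 1 / 2) (hΨ : Measurable Ψ) :
    ∫⁻ s in Ioo 0 t, (∫⁻ u in Ioo 0 s, epow (s - u) (-(1 - α)) * Ψ u) * epow (t - s) (-(2 * α)) ≤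
      betaBound (2 * α) (1 - α) * ∫⁻ u in Ioo 0 t, epow (t - u) (-α) * Ψ u := by
  have hmeas : Measurable (Function.uncurry fun u s =>
      epow (s - u) (-(1 - α)) * Ψ u * epow (t - s) (-(2 * α))) := by
    unfold Function.uncurry
    fun_prop
  have hswap : ∀ s, (∫⁻ u in Ioo 0 s, epow (s - u) (-(1 - α)) * Ψ u) * epow (t - s) (-(2 * α)) =
      ∫⁻ u in Ioo 0 s, epow (s - u) (-(1 - α)) * Ψ u * epow (t - s) (-(2 * α)) :=
    fun s => (lintegral_mul_const _ (by fun_prop)).symm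
  simp_rw [hswap]
  rw [← setLIntegral_Ioo_swap hmeas, ← lintegral_const_mul _ (by fun_prop)]
  refine setLIntegral_mono (by fun_prop) fun u hu => ?_
  calc _ = (∫⁻ s in Ioo u t, epow (t - s) (-(2 * α)) * epow (s - u) (-(1 - α))) * Ψ u := by
        rw [← lintegral_mul_const _ (by fun_prop)]
        exact lintegral_congr fun s => by ring
    _ ≤ betaBound (2 * α) (1 - α) * epow (t - u) (1 - 2 * α - (1 - α)) * Ψ u := by
        gcongr
        exact setLIntegral_beta_le hu.2 (by linarith) (by linarith) (by linarith) (by linarith)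
    _ = _ := by ring_nf

lemma setLIntegral_potential_le (hα : 0 < α) (hα' : α < 1 / 2) (hΨ : Measurable Ψ) :
    ∫⁻ s in Ioo 0 t, potential α s t Ψ * epow (t - s) (-(α + 1)) ≤
      (ENNReal.ofReal α⁻¹ + betaBound (2 * α) (1 - α)) *
        ∫⁻ u in Ioo 0 t, kernel α t u * Ψ u := by
  have hρ : Measurable fun u => epow u (-α) * Ψ u := by fun_prop
  have hmeas : Measurable fun s => (∫⁻ u in Ioo s t, epow u (-α) * Ψ u) * epow (t - s) (-(α + 1)) :=
    (measurable_setLIntegral_Ioo (f := fun _ u => epow u (-α) * Ψ u) (hρ.comp measurable_snd)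
      measurable_id measurable_const).mul (by fun_prop)
  calc _ = ∫⁻ s in Ioo 0 t, ((∫⁻ u in Ioo s t, epow u (-α) * Ψ u) * epow (t - s) (-(α + 1)) +
        (∫⁻ u in Ioo 0 s, epow (s - u) (-(1 - α)) * (epow u (-α) * Ψ u)) *
          epow (t - s) (-(2 * α))) := by
        refine setLIntegral_congr_fun measurableSet_Ioo fun s hs => ?_
        have hexp : epow (t - s) (-(2 * α)) = epow (t - s) (1 - α) * epow (t - s) (-(α + 1)) := by
          rw [epow_mul_epow (sub_pos.2 hs.2)]
          ring_nf
        simp only [potential, hexp, mul_assoc]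
        ring
    _ ≤ _ := by
        rw [lintegral_add_left hmeas, add_mul]
        simp only [kernel, mul_assoc]
        exact add_le_add (setLIntegral_setLIntegral_tail_le hα hρ)
          (setLIntegral_setLIntegral_beta_le hα hα' hρ)

end Potential

section IncrementBound

variable {E : Type*} [NormedAddCommGroup E] {α s t T : ℝ} {c c' C C' K : ℝ≥0∞}
  {Ψ Ψ' : ℝ → ℝ≥0∞} {h h' : ℝ → E}

/-- The increments of `h` on `[0,T]` are controlled by a `(1-α)`-Hölder term and the singular
potential of `Ψ`. -/
def IncrementBound (α T : ℝ) (c C : ℝ≥0∞) (Ψ : ℝ → ℝ≥0∞) (h : ℝ → E) : Prop :=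
  ∀ ⦃s t⦄, 0 ≤ s → s < t → t ≤ T →
    ‖h t - h s‖ₑ ≤ c * epow (t - s) (1 - α) + C * potential α s t Ψ

lemma IncrementBound.add (hh : IncrementBound α T c C Ψ h) (hh' : IncrementBound α T c' C' Ψ h') :
    IncrementBound α T (c + c') (C + C') Ψ fun t => h t + h' t := fun s t hs hst ht => calc
  ‖h t + h' t - (h s + h' s)‖ₑ ≤ ‖h t - h s‖ₑ + ‖h' t - h' s‖ₑ := by
      rw [add_sub_add_comm]
      exact enorm_add_le _ _
  _ ≤ _ := add_le_add (hh hs hst ht) (hh' hs hst ht)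
  _ = _ := by ring

lemma IncrementBound.mono (hh : IncrementBound α T c C Ψ h) (hK : K ≠ ∞)
    (hΨ : ∀ u ∈ Icc 0 T, Ψ u ≤ K * Ψ' u) : IncrementBound α T c (C * K) Ψ' h := by
  intro s t hs hst ht
  refine (hh hs hst ht).trans ?_
  rw [mul_assoc]
  gcongr
  exact potential_le_mul hK hs hst.le fun u hu => hΨ u ⟨hu.1, hu.2.trans ht⟩

lemma IncrementBound.indicator (hh : IncrementBound α T c C Ψ h) :
    IncrementBound α T c C ((Icc 0 T).indicator Ψ) h := by
  simpa only [mul_one] using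
    hh.mono ENNReal.one_ne_top fun u hu => by rw [indicator_of_mem hu, one_mul]

/-- The part of the `W_0^{α,∞}`-norm expression of `h - h(0)` at `t`, with the supremum-norm term
also taken with the weight `t^{-α}`. -/
def startNorm (α : ℝ) (h : ℝ → E) (t : ℝ) : ℝ≥0∞ :=
  ‖h t - h 0‖ₑ + epow t (-α) * ‖h t - h 0‖ₑ + incInt α 0 h t

lemma IncrementBound.incInt_le (hα : 0 < α) (hα' : α < 1 / 2) (hΨ : Measurable Ψ)
    (hh : IncrementBound α T c C Ψ h) (hC : C ≠ ∞) (ht : t ∈ Icc 0 T) :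
    incInt α 0 h t ≤ c * (ENNReal.ofReal (1 - 2 * α)⁻¹ * epow t (1 - 2 * α)) +
      C * ((ENNReal.ofReal α⁻¹ + betaBound (2 * α) (1 - α)) *
        ∫⁻ u in Ioo 0 t, kernel α t u * Ψ u) := by
  calc _ ≤ ∫⁻ s in Ioo 0 t,
        (c * epow (t - s) (-(2 * α)) + C * (potential α s t Ψ * epow (t - s) (-(α + 1)))) := by
        refine setLIntegral_mono' measurableSet_Ioo fun s hs => ?_
        have hexp : epow (t - s) (-(2 * α)) = epow (t - s) (1 - α) * epow (t - s) (-(α + 1)) := by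
          rw [epow_mul_epow (sub_pos.2 hs.2)]
          ring_nf
        rw [hexp, ← mul_assoc, ← mul_assoc, ← add_mul]
        gcongr
        exact hh hs.1.le hs.2 ht.2
    _ ≤ _ := by
        rw [lintegral_add_left (by fun_prop), lintegral_const_mul _ (by fun_prop),
          lintegral_const_mul' _ _ hC, setLIntegral_epow_sub_left ht.1 (by linarith), sub_zero]
        gcongr
        exact setLIntegral_potential_le hα hα' hΨ

lemma IncrementBound.epow_mul_enorm_sub_zero_le (hα : 0 < α) (hΨ : Measurable Ψ)
    (hh : IncrementBound α T c C Ψ h) (ht : t ∈ Ioc 0 T) :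
    epow t (-α) * ‖h t - h 0‖ₑ ≤
      c * epow t (1 - 2 * α) + C * ∫⁻ u in Ioo 0 t, kernel α t u * Ψ u := by
  have hexp : epow t (1 - 2 * α) = epow t (-α) * epow t (1 - α) := by
    rw [epow_mul_epow ht.1]
    ring_nf
  calc _ ≤ epow t (-α) * (c * epow t (1 - α) + C * ∫⁻ u in Ioo 0 t, epow u (-α) * Ψ u) := by
        gcongr
        simpa [potential_zero_left] using hh le_rfl ht.1 ht.2
    _ = c * epow t (1 - 2 * α) + C * ∫⁻ u in Ioo 0 t, epow t (-α) * (epow u (-α) * Ψ u) := by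
        rw [lintegral_const_mul _ (by fun_prop), hexp]
        ring
    _ ≤ _ := by
        gcongr _ + C * ?_
        refine setLIntegral_mono (by fun_prop) fun u hu => ?_
        rw [kernel, mul_assoc]
        gcongr
        exact epow_le_epow_of_nonpos (by linarith [hu.2]) (by linarith [hu.1]) (by linarith)

lemma IncrementBound.exists_startNorm_le (hα : 0 < α) (hα' : α < 1 / 2) (T : ℝ) (hC : C ≠ ∞) :
    ∃ K : ℝ≥0∞, K ≠ ∞ ∧ ∀ (c : ℝ≥0∞) (Ψ : ℝ → ℝ≥0∞) (h : ℝ → E), Measurable Ψ →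
      IncrementBound α T c C Ψ h → ∀ t ∈ Icc 0 T,
      startNorm α h t ≤ K * (c + ∫⁻ u in Ioo 0 t, kernel α t u * Ψ u) := by
  set B := ENNReal.ofReal (1 - 2 * α)⁻¹
  set D := ENNReal.ofReal α⁻¹ + betaBound (2 * α) (1 - α)
  set Q := epow T (1 - 2 * α)
  have hD : D ≠ ∞ := by finiteness [betaBound_ne_top (p := 2 * α) (q := 1 - α)]
  have hQ : Q ≠ ∞ := epow_ne_top
  refine ⟨(epow T α + 1) * (Q + C) + (B * Q + C * D), by finiteness [epow_ne_top (x := T) (p := α)],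
    fun c Ψ h hΨ hh t ht => ?_⟩
  rcases ht.1.eq_or_lt with rfl | ht0
  · simp [startNorm, incInt]
  set I := ∫⁻ u in Ioo 0 t, kernel α t u * Ψ u
  have hq : epow t (1 - 2 * α) ≤ Q := epow_le_epow ht.1 ht.2 (by linarith)
  have hweight : ‖h t - h 0‖ₑ ≤ epow T α * (epow t (-α) * ‖h t - h 0‖ₑ) := calc
    _ = epow t α * (epow t (-α) * ‖h t - h 0‖ₑ) := by
        rw [← mul_assoc, epow_mul_epow_neg ht0, one_mul]
    _ ≤ _ := by
        gcongr
        exact epow_le_epow ht.1 ht.2 hα.le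
  calc startNorm α h t
    _ ≤ (epow T α + 1) * (epow t (-α) * ‖h t - h 0‖ₑ) + incInt α 0 h t := by
        rw [add_mul, one_mul]
        unfold startNorm
        gcongr
    _ ≤ (epow T α + 1) * (c * Q + C * I) + (c * (B * Q) + C * (D * I)) := by
        gcongr
        · exact (hh.epow_mul_enorm_sub_zero_le hα hΨ ⟨ht0, ht.2⟩).trans (by gcongr)
        · exact (hh.incInt_le hα hα' hΨ hC ht).trans (by gcongr)
    _ = ((epow T α + 1) * Q + B * Q) * c + ((epow T α + 1) * C + C * D) * I := by ring
    _ ≤ ((epow T α + 1) * (Q + C) + (B * Q + C * D)) * c +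
          ((epow T α + 1) * (Q + C) + (B * Q + C * D)) * I := by
        gcongr
        exacts [le_self_add, le_self_add, le_add_self, le_add_self]
    _ = _ := (mul_add _ _ _).symm

lemma IncrementBound.exists_gronwall (hα : 0 < α) (hα' : α < 1 / 2) (T : ℝ) (hC : C ≠ ∞)
    {A : ℝ≥0∞} (hA : A ≠ ∞) :
    ∃ K : ℝ≥0∞, K ≠ ∞ ∧ ∀ (c a : ℝ≥0∞) (Ψ φ : ℝ → ℝ≥0∞) (h : ℝ → E), MeasOn 0 T Ψ →
      IncrementBound α T c C Ψ h → (⨆ t ∈ Icc 0 T, φ t) ≠ ∞ →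
      (∀ u ∈ Icc 0 T, Ψ u ≤ ⨆ v ∈ Icc 0 u, φ v) →
      (∀ t ∈ Icc 0 T, φ t ≤ a + A * startNorm α h t) → ∀ t ∈ Icc 0 T, φ t ≤ K * (a + c) := by
  obtain ⟨K₁, hK₁, hstart⟩ := IncrementBound.exists_startNorm_le (E := E) hα hα' T hC
  obtain ⟨K₂, hK₂, hgron⟩ := exists_gronwall_kernel hα hα' T (C := A * K₁) (by finiteness)
  refine ⟨K₂ * (1 + A * K₁), by finiteness, fun c a Ψ φ h hΨ hh hφ hΨφ hφh t ht => ?_⟩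
  refine (hgron φ (a + A * K₁ * c) hφ (fun t ht => (hφh t ht).trans ?_) t ht).trans ?_
  · calc _ ≤ a + A * (K₁ * (c + ∫⁻ u in Ioo 0 t, kernel α t u * (Icc 0 T).indicator Ψ u)) := by
          gcongr
          exact hstart c _ h hΨ.measurable_indicator hh.indicator t ht
      _ ≤ a + A * (K₁ * (c + ∫⁻ u in Ioo 0 t, kernel α t u * ⨆ v ∈ Icc 0 u, φ v)) := by
          gcongr a + A * (K₁ * (c + ?_))
          refine setLIntegral_mono' measurableSet_Ioo fun u hu => ?_
          have huT : u ∈ Icc 0 T := ⟨hu.1.le, hu.2.le.trans ht.2⟩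
          rw [indicator_of_mem huT]
          gcongr
          exact hΨφ u huT
      _ = _ := by ring
  · calc _ ≤ K₂ * ((1 + A * K₁) * a + (1 + A * K₁) * c) := by
          gcongr
          exacts [le_mul_of_one_le_left' le_self_add, le_add_self]
      _ = _ := by ring

end IncrementBound

section IntervalIntegrals

variable {E : Type*} [NormedAddCommGroup E] {a b : ℝ}

lemma measurable_intervalIntegral {f : ℝ → ℝ → ℝ} (hf : Measurable (Function.uncurry f))
    {l r : ℝ → ℝ} (hl : Measurable l) (hr : Measurable r) :
    Measurable fun s => ∫ u in l s..r s, f s u := by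
  have key : ∀ {l r : ℝ → ℝ}, Measurable l → Measurable r →
      Measurable fun s => ∫ u in Ioc (l s) (r s), f s u := by
    intro l r hl hr
    have hset : MeasurableSet {p : ℝ × ℝ | l p.1 < p.2 ∧ p.2 ≤ r p.1} :=
      (measurableSet_lt (hl.comp measurable_fst) measurable_snd).inter
        (measurableSet_le measurable_snd (hr.comp measurable_fst))
    convert (StronglyMeasurable.integral_prod_right' (ν := volume)
      (hf.indicator hset).stronglyMeasurable).measurable using 2 with s
    rw [← integral_indicator measurableSet_Ioc]
    rfl
  exact (key hl hr).sub (key hr hl)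

lemma enorm_intervalIntegral_le [NormedSpace ℝ E] (hab : a ≤ b) (f : ℝ → E) :
    ‖∫ u in a..b, f u‖ₑ ≤ ∫⁻ u in Ioo a b, ‖f u‖ₑ := by
  rw [intervalIntegral.integral_of_le hab, restrict_Ioo_eq_restrict_Ioc]
  exact enorm_integral_le_lintegral_enorm _

lemma intervalIntegrable_of_lintegral_enorm_ne_top (hab : a ≤ b) {f : ℝ → E}
    (hf : AEStronglyMeasurable f (volume.restrict (Ioo a b)))
    (h : ∫⁻ u in Ioo a b, ‖f u‖ₑ ≠ ∞) : IntervalIntegrable f volume a b := by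
  rw [intervalIntegrable_iff_integrableOn_Ioo_of_le hab]
  exact ⟨hf, h.lt_top⟩

lemma setLIntegral_Ioo_le_of_forall_lt {f : ℝ → ℝ≥0∞} {C : ℝ≥0∞}
    (h : ∀ v ∈ Ioo a b, ∫⁻ u in Ioo a v, f u ≤ C) : ∫⁻ u in Ioo a b, f u ≤ C := by
  rcases le_or_gt b a with hab | hab
  · simp [Ioo_eq_empty (not_lt.2 hab)]
  obtain ⟨v, hv, hvm, hvlim⟩ := exists_seq_strictMono_tendsto' hab
  have hU : Ioo a b = ⋃ n, Ioo a (v n) := by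
    refine subset_antisymm (fun u hu => ?_)
      (iUnion_subset fun n => Ioo_subset_Ioo_right (hvm n).2.le)
    obtain ⟨n, hn⟩ := (hvlim.eventually (lt_mem_nhds hu.2)).exists
    exact mem_iUnion.2 ⟨n, hu.1, hn⟩
  rw [hU, setLIntegral_iUnion_of_directed _ (directed_of_isDirected_le fun i j hij =>
    Ioo_subset_Ioo_right (hv.monotone hij))]
  exact iSup_le fun n => h (v n) (hvm n)

lemma enorm_div_rpow (x : ℝ) {y p : ℝ} (hy : 0 < y) : ‖x / y ^ p‖ₑ = ‖x‖ₑ * epow y (-p) := by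
  rw [← ofReal_norm_div_rpow x hy, ← ofReal_norm, norm_div,
    Real.norm_of_nonneg (Real.rpow_nonneg hy.le p)]

end IntervalIntegrals

section Integrators

variable {E : Type*} [NormedAddCommGroup E] {α T s t u : ℝ} {g : ℝ → E}

lemma le_wTNorm (hs : 0 < s) (hst : s < t) (ht : t < T) :
    ‖g t - g s‖ₑ * epow (t - s) (-(1 - α)) +
      ∫⁻ u in Ioo s t, ‖g u - g s‖ₑ * epow (u - s) (-(1 - α + 1)) ≤ wTNorm α T g := calc
  _ = ENNReal.ofReal (‖g t - g s‖ / (t - s) ^ (1 - α)) +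
      ∫⁻ u in Ioo s t, ENNReal.ofReal (‖g u - g s‖ / (u - s) ^ (2 - α)) := by
      rw [ofReal_norm_div_rpow _ (sub_pos.2 hst)]
      congr 1
      refine setLIntegral_congr_fun measurableSet_Ioo fun u hu => ?_
      rw [ofReal_norm_div_rpow _ (sub_pos.2 hu.1)]
      ring_nf
  _ ≤ _ := by
      unfold wTNorm
      exact le_iSup₂_of_le s ⟨hs, hst.trans ht⟩ (le_iSup₂_of_le t ⟨hst, ht⟩ le_rfl)

lemma enorm_sub_le_wTNorm (hs : 0 < s) (hst : s < t) (ht : t < T) :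
    ‖g t - g s‖ₑ ≤ wTNorm α T g * epow (t - s) (1 - α) :=
  (mul_epow_neg_le_iff (sub_pos.2 hst)).1 (le_self_add.trans (le_wTNorm hs hst ht))

lemma setLIntegral_le_wTNorm (hs : 0 < s) (ht : t ≤ T) :
    ∫⁻ u in Ioo s t, ‖g s - g u‖ₑ * epow (u - s) (-(1 - α + 1)) ≤ wTNorm α T g := by
  refine setLIntegral_Ioo_le_of_forall_lt fun v hv => ?_
  simp only [enorm_sub_rev (g s)]
  exact le_add_self.trans (le_wTNorm hs hv.1 (hv.2.trans_le ht))

lemma holderOnWith_of_wTNorm_ne_top (hg : wTNorm α T g ≠ ∞) (hα : α < 1) :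
    HolderOnWith (wTNorm α T g).toNNReal (1 - α).toNNReal g (Ioo 0 T) := by
  have key : ∀ s ∈ Ioo 0 T, ∀ t ∈ Ioo 0 T, s < t →
      edist (g t) (g s) ≤ wTNorm α T g * edist t s ^ (1 - α) := by
    intro s hs t ht hst
    rw [edist_eq_enorm_sub, edist_dist, Real.dist_eq, abs_of_pos (sub_pos.2 hst),
      ENNReal.ofReal_rpow_of_pos (sub_pos.2 hst)]
    exact enorm_sub_le_wTNorm hs.1 hst ht.2
  intro s hs t ht
  rw [ENNReal.coe_toNNReal hg, Real.coe_toNNReal _ (sub_pos.2 hα).le]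
  rcases lt_trichotomy s t with h | rfl | h
  · rw [edist_comm, edist_comm s]
    exact key s hs t ht h
  · simp
  · exact key t ht s hs h

lemma tendsto_leftLim_of_wTNorm_ne_top [CompleteSpace E] (hg : wTNorm α T g ≠ ∞) (hα : α < 1)
    (ht : 0 < t) (htT : t ≤ T) : Tendsto g (𝓝[<] t) (𝓝 (Function.leftLim g t)) := by
  have hunif := (holderOnWith_of_wTNorm_ne_top hg hα).uniformContinuousOn
    (Real.toNNReal_pos.2 (sub_pos.2 hα))
  have hcauchy : Cauchy (map g (𝓝[<] t)) :=
    (cauchy_nhds.mono nhdsWithin_le_nhds).map_of_le hunif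
      (le_principal_iff.2 (mem_of_superset (Ioo_mem_nhdsLT ht) (Ioo_subset_Ioo_right htT)))
  exact tendsto_leftLim_of_tendsto (cauchy_iff_exists_le_nhds.1 hcauchy)

lemma leftLim_eq_of_wTNorm_ne_top (hg : wTNorm α T g ≠ ∞) (hα : α < 1) (hs : 0 < s)
    (hsT : s < T) : Function.leftLim g s = g s := by
  have hcont := (holderOnWith_of_wTNorm_ne_top hg hα).continuousOn
    (Real.toNNReal_pos.2 (sub_pos.2 hα))
  exact (hcont.continuousAt (Ioo_mem_nhds hs hsT)).continuousWithinAt.leftLim_eq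

lemma enorm_sub_leftLim_le [CompleteSpace E] (hg : wTNorm α T g ≠ ∞) (hα : α < 1) (hu : 0 < u)
    (hut : u < t) (htT : t ≤ T) :
    ‖g u - Function.leftLim g t‖ₑ ≤ wTNorm α T g * epow (t - u) (1 - α) := by
  have hlim := tendsto_leftLim_of_wTNorm_ne_top hg hα (hu.trans hut) htT
  refine le_of_tendsto ((tendsto_const_nhds (x := g u)).sub hlim).enorm ?_
  filter_upwards [Ioo_mem_nhdsLT hut] with v hv
  rw [enorm_sub_rev]
  refine (enorm_sub_le_wTNorm (α := α) hu hv.1 (hv.2.trans_le htT)).trans ?_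
  gcongr
  exact epow_le_epow (by linarith [hv.1]) (by linarith [hv.2]) (by linarith)

end Integrators

section WeylRight

variable {α T s t u : ℝ} {g : ℝ → ℝ}

lemma intervalIntegrable_weylRight (hg : MemWT α T g) (hu : 0 < u) (hut : u ≤ t) (htT : t ≤ T) :
    IntervalIntegrable (fun y => (g u - g y) / (y - u) ^ (1 - α + 1)) volume u t := by
  refine intervalIntegrable_of_lintegral_enorm_ne_top hut ?_
    (ne_top_of_le_ne_top hg.2.ne (le_trans (le_of_eq ?_) (setLIntegral_le_wTNorm hu htT)))
  · exact (aestronglyMeasurable_const.sub (hg.1.aestronglyMeasurable hu.le htT)).div₀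
      (by fun_prop : Measurable fun y : ℝ => (y - u) ^ (1 - α + 1)).aestronglyMeasurable
  · exact setLIntegral_congr_fun measurableSet_Ioo fun y hy => enorm_div_rpow _ (sub_pos.2 hy.1)

/-- A bound for the right-sided Weyl derivatives of order `1 - α` of a function whose norm in
`W_T^{1-α,∞}` is `Λ`. -/
def weylBound (α : ℝ) (Λ : ℝ≥0∞) : ℝ≥0∞ := ENNReal.ofReal (Real.Gamma α)⁻¹ * (Λ * 2)

lemma weylBound_ne_top {Λ : ℝ≥0∞} (hΛ : Λ ≠ ∞) : weylBound α Λ ≠ ∞ := by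
  unfold weylBound
  finiteness

lemma weylRight_eq (c : ℝ) : weylRight (1 - α) t (fun v => g v - c) u = (Real.Gamma α)⁻¹ *
    ((g u - c) / (t - u) ^ (1 - α) +
      (1 - α) * ∫ y in u..t, (g u - g y) / (y - u) ^ (1 - α + 1)) := by
  simp [weylRight]

lemma enorm_inv_Gamma (hα : 0 < α) :
    ‖(Real.Gamma α)⁻¹‖ₑ = ENNReal.ofReal (Real.Gamma α)⁻¹ :=
  Real.enorm_of_nonneg (inv_nonneg.2 (Real.Gamma_pos_of_pos hα).le)

lemma enorm_weylRight_le (hg : MemWT α T g) (hα : 0 < α) (hα' : α < 1) (hu : 0 < u) (hut : u < t)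
    (htT : t ≤ T) : ‖weylRight (1 - α) t (fun v => g v - Function.leftLim g t) u‖ₑ ≤
      weylBound α (wTNorm α T g) := by
  rw [weylRight_eq, enorm_mul, enorm_inv_Gamma hα, weylBound, mul_two]
  gcongr
  refine (enorm_add_le _ _).trans (add_le_add ?_ ?_)
  · rw [enorm_div_rpow _ (sub_pos.2 hut)]
    exact (mul_epow_neg_le_iff (sub_pos.2 hut)).2 (enorm_sub_leftLim_le hg.2.ne hα' hu hut htT)
  · rw [enorm_mul, Real.enorm_of_nonneg (sub_pos.2 hα').le]
    calc _ ≤ 1 * ∫⁻ y in Ioo u t, ‖(g u - g y) / (y - u) ^ (1 - α + 1)‖ₑ := by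
          gcongr
          · exact ENNReal.ofReal_le_one.2 (by linarith)
          · exact enorm_intervalIntegral_le hut.le _
      _ = ∫⁻ y in Ioo u t, ‖g u - g y‖ₑ * epow (y - u) (-(1 - α + 1)) := by
          rw [one_mul]
          exact setLIntegral_congr_fun measurableSet_Ioo fun y hy =>
            enorm_div_rpow _ (sub_pos.2 hy.1)
      _ ≤ _ := setLIntegral_le_wTNorm hu htT

lemma integral_rpow_tail (hα : α < 1) (hus : u < s) (hst : s ≤ t) :
    (1 - α) * ∫ y in s..t, (y - u) ^ (-(1 - α + 1)) =
      ((s - u) ^ (1 - α))⁻¹ - ((t - u) ^ (1 - α))⁻¹ := by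
  have h0 : (0 : ℝ) ∉ uIcc (s - u) (t - u) := by
    rw [uIcc_of_le (by linarith)]
    exact fun h => absurd h.1 (by linarith)
  have h1 : 1 - α ≠ 0 := by linarith
  rw [intervalIntegral.integral_comp_sub_right (fun y => y ^ (-(1 - α + 1))) u,
    integral_rpow (Or.inr ⟨by intro h; apply h1; linarith, h0⟩),
    show -(1 - α + 1) + 1 = -(1 - α) by ring, Real.rpow_neg (by linarith),
    Real.rpow_neg (by linarith)]
  field_simp
  ring

lemma integral_sub_div_rpow (hα : α < 1) (hus : u < s) (hst : s ≤ t)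
    (hi : IntervalIntegrable (fun y => (g u - g y) / (y - u) ^ (1 - α + 1)) volume s t) :
    (1 - α) * ∫ y in s..t, (g s - g y) / (y - u) ^ (1 - α + 1) =
      (1 - α) * (∫ y in s..t, (g u - g y) / (y - u) ^ (1 - α + 1)) -
        (g u - g s) * (((s - u) ^ (1 - α))⁻¹ - ((t - u) ^ (1 - α))⁻¹) := by
  have hpow : IntervalIntegrable (fun y => (y - u) ^ (-(1 - α + 1))) volume s t := by
    apply ContinuousOn.intervalIntegrable
    rw [uIcc_of_le hst]
    exact ContinuousOn.rpow_const (by fun_prop) fun y hy => Or.inl (by linarith [hy.1])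
  have hsplit : ∫ y in s..t, (g s - g y) / (y - u) ^ (1 - α + 1) =
      (∫ y in s..t, (g u - g y) / (y - u) ^ (1 - α + 1)) -
        (g u - g s) * ∫ y in s..t, (y - u) ^ (-(1 - α + 1)) := by
    rw [← intervalIntegral.integral_const_mul,
      ← intervalIntegral.integral_sub hi (hpow.const_mul _)]
    refine intervalIntegral.integral_congr fun y hy => ?_
    rw [uIcc_of_le hst] at hy
    rw [Real.rpow_neg (by linarith [hy.1])]
    field_simp
    ring
  rw [hsplit, ← integral_rpow_tail hα hus hst]
  ring

lemma weylRight_sub (hg : MemWT α T g) (hα : α < 1) (hu : 0 < u) (hus : u < s) (hst : s < t)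
    (htT : t ≤ T) :
    weylRight (1 - α) t (fun v => g v - Function.leftLim g t) u -
      weylRight (1 - α) s (fun v => g v - Function.leftLim g s) u =
    (Real.Gamma α)⁻¹ * ((g s - Function.leftLim g t) / (t - u) ^ (1 - α) +
      (1 - α) * ∫ y in s..t, (g s - g y) / (y - u) ^ (1 - α + 1)) := by
  have hsT : s < T := hst.trans_le htT
  have hut := intervalIntegrable_weylRight hg hu (hus.trans hst).le htT
  have hus' := intervalIntegrable_weylRight hg hu hus.le hsT.le
  rw [weylRight_eq, weylRight_eq, leftLim_eq_of_wTNorm_ne_top hg.2.ne hα (hu.trans hus) hsT,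
    integral_sub_div_rpow hα hus hst.le (hus'.symm.trans hut),
    ← intervalIntegral.integral_interval_sub_left hut hus']
  ring

lemma enorm_integral_tail_le (hα : α < 1) (hs : 0 < s) (hus : u < s)
    (hst : s < t) (htT : t ≤ T) :
    ‖(1 - α) * ∫ y in s..t, (g s - g y) / (y - u) ^ (1 - α + 1)‖ₑ ≤
      wTNorm α T g * (epow (t - s) (1 - α) * epow (s - u) (-(1 - α))) := by
  have h1α : 0 < 1 - α := sub_pos.2 hα
  rw [enorm_mul, Real.enorm_of_nonneg h1α.le]
  calc _ ≤ ENNReal.ofReal (1 - α) * ∫⁻ y in Ioo s t,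
        wTNorm α T g * epow (t - s) (1 - α) * epow (y - u) (-(1 - α + 1)) := by
        gcongr
        refine (enorm_intervalIntegral_le hst.le _).trans
          (setLIntegral_mono' measurableSet_Ioo fun y hy => ?_)
        rw [enorm_div_rpow _ (by linarith [hy.1]), enorm_sub_rev]
        gcongr
        refine (enorm_sub_le_wTNorm (α := α) hs hy.1 (hy.2.trans_le htT)).trans ?_
        gcongr
        exact epow_le_epow (by linarith [hy.1]) (by linarith [hy.2]) h1α.le
    _ ≤ ENNReal.ofReal (1 - α) * (wTNorm α T g * epow (t - s) (1 - α) *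
        (ENNReal.ofReal (1 - α)⁻¹ * epow (s - u) (-(1 - α)))) := by
        rw [lintegral_const_mul _ (by fun_prop)]
        gcongr
        exact setLIntegral_epow_tail_right_le hus h1α
    _ = (ENNReal.ofReal (1 - α) * ENNReal.ofReal (1 - α)⁻¹) * (wTNorm α T g *
        (epow (t - s) (1 - α) * epow (s - u) (-(1 - α)))) := by ring
    _ = _ := by
        rw [← ENNReal.ofReal_mul h1α.le, mul_inv_cancel₀ h1α.ne', ENNReal.ofReal_one, one_mul]

lemma enorm_weylRight_sub_le (hg : MemWT α T g) (hα : 0 < α) (hα' : α < 1) (hu : 0 < u)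
    (hus : u < s) (hst : s < t) (htT : t ≤ T) :
    ‖weylRight (1 - α) t (fun v => g v - Function.leftLim g t) u -
      weylRight (1 - α) s (fun v => g v - Function.leftLim g s) u‖ₑ ≤
    weylBound α (wTNorm α T g) * (epow (t - s) (1 - α) * epow (s - u) (-(1 - α))) := by
  have hs : 0 < s := hu.trans hus
  rw [weylRight_sub hg hα' hu hus hst htT, enorm_mul, enorm_inv_Gamma hα, weylBound, mul_assoc]
  gcongr
  rw [mul_two, add_mul]
  refine (enorm_add_le _ _).trans (add_le_add ?_ (enorm_integral_tail_le hα' hs hus hst htT))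
  rw [enorm_div_rpow _ (by linarith), ← mul_assoc]
  gcongr
  · exact enorm_sub_leftLim_le hg.2.ne hα' hs hst htT
  · exact epow_le_epow_of_nonpos (sub_pos.2 hus) (by linarith) (by linarith)

lemma aestronglyMeasurable_weylRight (hg : MeasOn 0 T g) (γ c : ℝ) (htT : t ≤ T) :
    AEStronglyMeasurable (weylRight γ t (fun v => g v - c)) (volume.restrict (Ioo 0 t)) := by
  set g' := (Icc 0 T).indicator g
  have hg' : ∀ x, 0 ≤ x → x ≤ t → g' x = g x := fun x hx hxt =>
    indicator_of_mem (show x ∈ Icc 0 T from ⟨hx, hxt.trans htT⟩) g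
  have hm : Measurable g' := hg.measurable_indicator
  have hint : Measurable fun x => ∫ y in x..t, (g' x - g' y) / (y - x) ^ (γ + 1) :=
    measurable_intervalIntegral (f := fun x y => (g' x - g' y) / (y - x) ^ (γ + 1))
      (by unfold Function.uncurry; fun_prop) measurable_id measurable_const
  have hw : Measurable (fun x => (Real.Gamma (1 - γ))⁻¹ * ((g' x - c) / (t - x) ^ γ +
      γ * ∫ y in x..t, (g' x - g' y) / (y - x) ^ (γ + 1))) := by fun_prop
  refine hw.aestronglyMeasurable.congr ((ae_restrict_iff' measurableSet_Ioo).2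
    (ae_of_all _ fun x hx => ?_))
  simp only [weylRight, sub_sub_sub_cancel_right, hg' x hx.1.le hx.2.le]
  congr 3
  refine intervalIntegral.integral_congr fun y hy => ?_
  rw [uIcc_of_le hx.2.le] at hy
  simp only [hg' y (hx.1.le.trans hy.1) hy.2]

end WeylRight

section WeylLeft

variable {α T t u : ℝ} {f f' : ℝ → ℝ}

lemma enorm_sub_div_rpow {y : ℝ} (hy : y < u) :
    ‖(f u - f y) / (u - y) ^ (α + 1)‖ₑ = ‖f u - f y‖ₑ * epow (u - y) (-(α + 1)) :=
  enorm_div_rpow _ (sub_pos.2 hy)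

/-- A constant comparing the left-sided Weyl derivative at `u ∈ (0,T]` with `u^{-α} wPt α 0 f u`. -/
def leftBound (α T : ℝ) : ℝ≥0∞ := ENNReal.ofReal (Real.Gamma (1 - α))⁻¹ * (1 + epow T α)

lemma leftBound_ne_top : leftBound α T ≠ ∞ := by
  unfold leftBound
  finiteness [epow_ne_top (x := T) (p := α)]

lemma enorm_weylLeft_le (hα : 0 < α) (hα' : α < 1) (hu : u ∈ Ioc 0 T) :
    ‖weylLeft α 0 f u‖ₑ ≤ leftBound α T * (epow u (-α) * wPt α 0 f u) := by
  have hint : ‖α * ∫ y in (0 : ℝ)..u, (f u - f y) / (u - y) ^ (α + 1)‖ₑ ≤ incInt α 0 f u := calc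
    _ ≤ 1 * ∫⁻ y in Ioo 0 u, ‖(f u - f y) / (u - y) ^ (α + 1)‖ₑ := by
        rw [enorm_mul, Real.enorm_of_nonneg hα.le]
        gcongr
        · exact ENNReal.ofReal_le_one.2 hα'.le
        · exact enorm_intervalIntegral_le hu.1.le _
    _ = _ := by
        rw [one_mul]
        exact setLIntegral_congr_fun measurableSet_Ioo fun y hy => enorm_sub_div_rpow hy.2
  rw [weylLeft, enorm_mul, enorm_inv_Gamma (sub_pos.2 hα'), leftBound, mul_assoc, add_mul, one_mul]
  gcongr
  refine (enorm_add_le _ _).trans (add_le_add ?_ ?_)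
  · rw [sub_zero, enorm_div_rpow _ hu.1, mul_comm]
    gcongr
    exact enorm_le_wPt
  · calc _ ≤ (epow u α * epow u (-α)) * wPt α 0 f u := by
          rw [epow_mul_epow_neg hu.1, one_mul]
          exact hint.trans incInt_le_wPt
      _ ≤ _ := by
          rw [← mul_assoc]
          gcongr
          exact epow_le_epow hu.1.le hu.2 hα.le

lemma intervalIntegrable_sub_div_rpow (hf : MemW α 0 T f) (hu : u ∈ Icc 0 T) :
    IntervalIntegrable (fun y => (f u - f y) / (u - y) ^ (α + 1)) volume 0 u := by
  have hfin : incInt α 0 f u ≠ ∞ :=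
    ne_top_of_le_ne_top hf.2.ne (incInt_le_wPt.trans (wPt_le_wNorm hu))
  refine intervalIntegrable_of_lintegral_enorm_ne_top hu.1 ?_ (ne_of_eq_of_ne ?_ hfin)
  · exact (aestronglyMeasurable_const.sub (hf.1.aestronglyMeasurable le_rfl hu.2)).div₀
      (by fun_prop : Measurable fun y : ℝ => (u - y) ^ (α + 1)).aestronglyMeasurable
  · exact setLIntegral_congr_fun measurableSet_Ioo fun y hy => enorm_sub_div_rpow hy.2

lemma weylLeft_sub (hf : MemW α 0 T f) (hf' : MemW α 0 T f') (hu : u ∈ Icc 0 T) :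
    weylLeft α 0 (fun s => f s - f' s) u = weylLeft α 0 f u - weylLeft α 0 f' u := by
  have hint : ∫ y in (0 : ℝ)..u, ((f u - f' u) - (f y - f' y)) / (u - y) ^ (α + 1) =
      (∫ y in (0 : ℝ)..u, (f u - f y) / (u - y) ^ (α + 1)) -
        ∫ y in (0 : ℝ)..u, (f' u - f' y) / (u - y) ^ (α + 1) := by
    rw [← intervalIntegral.integral_sub (intervalIntegrable_sub_div_rpow hf hu)
      (intervalIntegrable_sub_div_rpow hf' hu)]
    refine intervalIntegral.integral_congr fun y _ => ?_
    ring
  simp only [weylLeft, hint]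
  ring

lemma aestronglyMeasurable_weylLeft (hf : MeasOn 0 T f) (ht : t ≤ T) :
    AEStronglyMeasurable (weylLeft α 0 f) (volume.restrict (Ioo 0 t)) := by
  set f' := (Icc 0 T).indicator f
  have hf' : ∀ x, 0 ≤ x → x ≤ t → f' x = f x := fun x hx hxt =>
    indicator_of_mem (show x ∈ Icc 0 T from ⟨hx, hxt.trans ht⟩) f
  have hm : Measurable f' := hf.measurable_indicator
  have hint : Measurable fun x => ∫ y in (0 : ℝ)..x, (f' x - f' y) / (x - y) ^ (α + 1) :=
    measurable_intervalIntegral (f := fun x y => (f' x - f' y) / (x - y) ^ (α + 1))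
      (by unfold Function.uncurry; fun_prop) measurable_const measurable_id
  have hw : Measurable (weylLeft α 0 f') := by
    unfold weylLeft
    fun_prop
  refine hw.aestronglyMeasurable.congr ((ae_restrict_iff' measurableSet_Ioo).2
    (ae_of_all _ fun x hx => ?_))
  simp only [weylLeft, hf' x hx.1.le hx.2.le]
  congr 3
  refine intervalIntegral.integral_congr fun y hy => ?_
  rw [uIcc_of_le hx.1.le] at hy
  simp only [hf' y hy.1 (hy.2.trans hx.2.le)]

lemma intervalIntegrable_weylLeft (hα : 0 < α) (hα' : α < 1) (hf : MemW α 0 T f)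
    (ht : t ∈ Icc 0 T) : IntervalIntegrable (weylLeft α 0 f) volume 0 t := by
  refine intervalIntegrable_of_lintegral_enorm_ne_top ht.1
    (aestronglyMeasurable_weylLeft hf.1 ht.2) ?_
  have hbound : ∫⁻ u in Ioo 0 t, ‖weylLeft α 0 f u‖ₑ ≤
      leftBound α T * ((ENNReal.ofReal (1 - α)⁻¹ * epow t (1 - α)) * wNorm α 0 T f) := by
    rw [← setLIntegral_Ioo_zero_epow ht.1 hα', ← lintegral_mul_const _ (by fun_prop),
      ← lintegral_const_mul _ (by fun_prop)]
    refine setLIntegral_mono (by fun_prop) fun u hu => ?_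
    have huT : u ≤ T := hu.2.le.trans ht.2
    refine (enorm_weylLeft_le hα hα' ⟨hu.1, huT⟩).trans ?_
    gcongr
    exact wPt_le_wNorm ⟨hu.1.le, huT⟩
  refine ne_top_of_le_ne_top ?_ hbound
  finiteness [leftBound_ne_top (α := α) (T := T), epow_ne_top (x := t) (p := 1 - α), hf.2.ne]

end WeylLeft

section Stieltjes

variable {α T s t : ℝ} {f f' g : ℝ → ℝ}

/-- The product of Weyl derivatives whose integral over `[0,t]` is `-∫_0^t f dg`. -/
def weylProd (α t : ℝ) (f g : ℝ → ℝ) (u : ℝ) : ℝ :=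
  weylLeft α 0 f u * weylRight (1 - α) t (fun v => g v - Function.leftLim g t) u

lemma stieltjes_eq : stieltjes α 0 t f g = -∫ u in (0 : ℝ)..t, weylProd α t f g u := rfl

lemma intervalIntegrable_weylProd (hα : 0 < α) (hα' : α < 1) (hf : MemW α 0 T f)
    (hg : MemWT α T g) (ht : t ∈ Icc 0 T) : IntervalIntegrable (weylProd α t f g) volume 0 t := by
  have hleft := intervalIntegrable_weylLeft hα hα' hf ht
  rw [intervalIntegrable_iff_integrableOn_Ioo_of_le ht.1] at hleft ⊢
  refine hleft.mul_bdd (c := (weylBound α (wTNorm α T g)).toReal)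
    (aestronglyMeasurable_weylRight hg.1 _ _ ht.2) ?_
  refine (ae_restrict_iff' measurableSet_Ioo).2 (ae_of_all _ fun x hx => ?_)
  rw [← toReal_enorm]
  exact ENNReal.toReal_mono (weylBound_ne_top hg.2.ne)
    (enorm_weylRight_le hg hα hα' hx.1 hx.2 ht.2)

lemma stieltjes_sub (hα : 0 < α) (hα' : α < 1) (hf : MemW α 0 T f) (hf' : MemW α 0 T f')
    (hg : MemWT α T g) (ht : t ∈ Icc 0 T) :
    stieltjes α 0 t (fun s => f s - f' s) g = stieltjes α 0 t f g - stieltjes α 0 t f' g := by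
  simp only [stieltjes_eq]
  rw [← neg_sub', ← intervalIntegral.integral_sub (intervalIntegrable_weylProd hα hα' hf hg ht)
    (intervalIntegrable_weylProd hα hα' hf' hg ht)]
  congr 1
  refine intervalIntegral.integral_congr fun u hu => ?_
  rw [uIcc_of_le ht.1] at hu
  simp only [weylProd, weylLeft_sub hf hf' ⟨hu.1, hu.2.trans ht.2⟩, sub_mul]

lemma stieltjes_sub_stieltjes (hα : 0 < α) (hα' : α < 1) (hf : MemW α 0 T f) (hg : MemWT α T g)
    (hs : 0 ≤ s) (hst : s ≤ t) (htT : t ≤ T) :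
    stieltjes α 0 t f g - stieltjes α 0 s f g = -((∫ u in s..t, weylProd α t f g u) +
      ∫ u in (0 : ℝ)..s, (weylProd α t f g u - weylProd α s f g u)) := by
  have ht := intervalIntegrable_weylProd hα hα' hf hg ⟨hs.trans hst, htT⟩
  have hs' := intervalIntegrable_weylProd hα hα' hf hg ⟨hs, hst.trans htT⟩
  have hts : IntervalIntegrable (weylProd α t f g) volume 0 s := ht.mono_set (by
    rw [uIcc_of_le hs, uIcc_of_le (hs.trans hst)]
    exact Icc_subset_Icc_right hst)
  rw [stieltjes_eq, stieltjes_eq, intervalIntegral.integral_sub hts hs',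
    ← intervalIntegral.integral_add_adjacent_intervals hts (hts.symm.trans ht)]
  ring

lemma enorm_integral_weylProd_le (hα : 0 < α) (hα' : α < 1) (hg : MemWT α T g) (hs : 0 ≤ s)
    (hst : s ≤ t) (htT : t ≤ T) :
    ‖∫ u in s..t, weylProd α t f g u‖ₑ ≤ leftBound α T * weylBound α (wTNorm α T g) *
      ∫⁻ u in Ioo s t, epow u (-α) * wPt α 0 f u := by
  rw [← lintegral_const_mul' _ _ (ENNReal.mul_ne_top leftBound_ne_top (weylBound_ne_top hg.2.ne))]
  refine (enorm_intervalIntegral_le hst _).trans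
    (setLIntegral_mono' measurableSet_Ioo fun u hu => ?_)
  have hu0 : 0 < u := hs.trans_lt hu.1
  rw [weylProd, enorm_mul, mul_right_comm]
  exact mul_le_mul' (enorm_weylLeft_le hα hα' ⟨hu0, hu.2.le.trans htT⟩)
    (enorm_weylRight_le hg hα hα' hu0 hu.2 htT)

lemma enorm_integral_weylProd_sub_le (hα : 0 < α) (hα' : α < 1) (hg : MemWT α T g) (hs : 0 ≤ s)
    (hst : s < t) (htT : t ≤ T) :
    ‖∫ u in (0 : ℝ)..s, (weylProd α t f g u - weylProd α s f g u)‖ₑ ≤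
      leftBound α T * weylBound α (wTNorm α T g) * (epow (t - s) (1 - α) *
        ∫⁻ u in Ioo 0 s, epow (s - u) (-(1 - α)) * epow u (-α) * wPt α 0 f u) := by
  rw [← lintegral_const_mul' _ _ epow_ne_top,
    ← lintegral_const_mul' _ _ (ENNReal.mul_ne_top leftBound_ne_top (weylBound_ne_top hg.2.ne))]
  refine (enorm_intervalIntegral_le hs _).trans
    (setLIntegral_mono' measurableSet_Ioo fun u hu => ?_)
  rw [weylProd, weylProd, ← mul_sub, enorm_mul]
  calc _ ≤ (leftBound α T * (epow u (-α) * wPt α 0 f u)) *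
        (weylBound α (wTNorm α T g) * (epow (t - s) (1 - α) * epow (s - u) (-(1 - α)))) :=
        mul_le_mul' (enorm_weylLeft_le hα hα' ⟨hu.1, by linarith [hu.2]⟩)
          (enorm_weylRight_sub_le hg hα hα' hu.1 hu.2 hst htT)
    _ = _ := by ring

lemma incrementBound_stieltjes (hα : 0 < α) (hα' : α < 1) (hf : MemW α 0 T f)
    (hg : MemWT α T g) :
    IncrementBound α T 0 (leftBound α T * weylBound α (wTNorm α T g)) (wPt α 0 f)
      (fun t => stieltjes α 0 t f g) := by
  intro s t hs hst htT
  rw [stieltjes_sub_stieltjes hα hα' hf hg hs hst.le htT, enorm_neg, zero_mul, zero_add, potential,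
    mul_add]
  exact (enorm_add_le _ _).trans (add_le_add (enorm_integral_weylProd_le hα hα' hg hs hst.le htT)
    (enorm_integral_weylProd_sub_le hα hα' hg hs hst htT))

end Stieltjes

section Components

lemma MeasOn.apply {κ : Type*} {a b : ℝ} {A : ℝ → EuclideanSpace ℝ κ} (hA : MeasOn a b A)
    (i : κ) : MeasOn a b fun s => A s i :=
  (by fun_prop : Measurable fun v : EuclideanSpace ℝ κ => v i).comp hA

variable {ι : Type*} [Fintype ι] {α a b T t : ℝ}

lemma enorm_apply_le (v : EuclideanSpace ℝ ι) (i : ι) : ‖v i‖ₑ ≤ ‖v‖ₑ :=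
  enorm_le_iff_norm_le.2 (PiLp.norm_apply_le v i)

lemma enorm_le_sum (v : EuclideanSpace ℝ ι) : ‖v‖ₑ ≤ ∑ i, ‖v i‖ₑ := by
  classical
  calc ‖v‖ₑ = ‖∑ i, EuclideanSpace.single i (v i)‖ₑ := by
        congr 1
        ext j
        simp
    _ ≤ _ := (enorm_sum_le _ _).trans_eq (by simp [enorm_eq_nnnorm])

lemma wPt_apply_le (A : ℝ → EuclideanSpace ℝ ι) (i : ι) :
    wPt α a (fun s => A s i) t ≤ wPt α a A t := by
  unfold wPt incInt
  gcongr with s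
  · exact enorm_apply_le _ i
  · exact enorm_apply_le (A t - A s) i

lemma MemW.apply {A : ℝ → EuclideanSpace ℝ ι} (hA : MemW α a b A) (i : ι) :
    MemW α a b fun s => A s i := by
  refine ⟨hA.1.apply i, lt_of_le_of_lt ?_ hA.2⟩
  rw [wNorm_eq_iSup_wPt]
  exact iSup₂_le fun t ht => (wPt_apply_le A i).trans (wPt_le_wNorm ht)

lemma wTNorm_apply_le (g : ℝ → EuclideanSpace ℝ ι) (i : ι) :
    wTNorm α T (fun s => g s i) ≤ wTNorm α T g := by
  refine iSup₂_mono fun s _ => iSup₂_mono fun t ht => add_le_add ?_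
    (setLIntegral_mono' measurableSet_Ioo fun u hu => ?_)
  · gcongr
    · exact Real.rpow_nonneg (sub_pos.2 ht.1).le _
    · exact PiLp.norm_apply_le (g t - g s) i
  · gcongr
    · exact Real.rpow_nonneg (sub_pos.2 hu.1).le _
    · exact PiLp.norm_apply_le (g u - g s) i

lemma MemWT.apply {g : ℝ → EuclideanSpace ℝ ι} (hg : MemWT α T g) (i : ι) :
    MemWT α T fun s => g s i :=
  ⟨hg.1.apply i, (wTNorm_apply_le g i).trans_lt hg.2⟩

end Components

section VectorStieltjes

variable {d m : ℕ} {α T t : ℝ} {A A' : ℝ → EuclideanSpace ℝ (Fin d × Fin m)}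
  {g : ℝ → EuclideanSpace ℝ (Fin m)}

lemma vecStieltjes_zero : vecStieltjes α 0 A g = 0 := by
  ext i
  simp [vecStieltjes, stieltjes]

lemma vecStieltjes_sub (hα : 0 < α) (hα' : α < 1) (hA : MemW α 0 T A) (hA' : MemW α 0 T A')
    (hg : MemWT α T g) (ht : t ∈ Icc 0 T) :
    vecStieltjes α t (fun s => A s - A' s) g = vecStieltjes α t A g - vecStieltjes α t A' g := by
  ext i
  simp only [vecStieltjes, PiLp.sub_apply, ← Finset.sum_sub_distrib]
  exact Finset.sum_congr rfl fun j _ =>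
    stieltjes_sub hα hα' (hA.apply _) (hA'.apply _) (hg.apply j) ht

lemma incrementBound_stieltjes_apply (hα : 0 < α) (hα' : α < 1) (hA : MemW α 0 T A)
    (hg : MemWT α T g) (i : Fin d) (j : Fin m) :
    IncrementBound α T 0 (leftBound α T * weylBound α (wTNorm α T g)) (wPt α 0 A)
      (fun t => stieltjes α 0 t (fun s => A s (i, j)) (fun s => g s j)) := by
  intro s t hs hst htT
  refine ((incrementBound_stieltjes hα hα' (hA.apply (i, j)) (hg.apply j)).mono (Ψ' := wPt α 0 A)
    ENNReal.one_ne_top (fun u _ => ?_) hs hst htT).trans ?_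
  · rw [one_mul]
    exact wPt_apply_le A (i, j)
  · rw [mul_one]
    unfold weylBound
    gcongr
    exact wTNorm_apply_le g j

lemma incrementBound_vecStieltjes (hα : 0 < α) (hα' : α < 1) (hA : MemW α 0 T A)
    (hg : MemWT α T g) :
    IncrementBound α T 0 (d * (m * (leftBound α T * weylBound α (wTNorm α T g)))) (wPt α 0 A)
      (fun t => vecStieltjes α t A g) := by
  intro s t hs hst htT
  rw [zero_mul, zero_add]
  set B := leftBound α T * weylBound α (wTNorm α T g)
  calc _ ≤ ∑ i : Fin d, ∑ j : Fin m,
        ‖stieltjes α 0 t (fun s => A s (i, j)) (fun s => g s j) -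
          stieltjes α 0 s (fun s => A s (i, j)) (fun s => g s j)‖ₑ := by
        refine (enorm_le_sum _).trans (Finset.sum_le_sum fun _ _ => ?_)
        simp only [vecStieltjes, PiLp.sub_apply, ← Finset.sum_sub_distrib]
        exact enorm_sum_le _ _
    _ ≤ ∑ _ : Fin d, ∑ _ : Fin m, B * potential α s t (wPt α 0 A) :=
        Finset.sum_le_sum fun _ _ => Finset.sum_le_sum fun _ _ => by
          simpa only [zero_mul, zero_add] using
            incrementBound_stieltjes_apply hα hα' hA hg _ _ hs hst htT
    _ = _ := by
        simp only [Finset.sum_const, Finset.card_univ, Fintype.card_fin, nsmul_eq_mul]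
        ring

end VectorStieltjes

section FourPoint

variable {E F : Type*} [NormedAddCommGroup E] [NormedSpace ℝ E] [NormedAddCommGroup F]
  [NormedSpace ℝ F]

lemma enorm_lineMap_le {x y : E} {ρ : ℝ≥0∞} {θ : ℝ} (hx : ‖x‖ₑ ≤ ρ) (hy : ‖y‖ₑ ≤ ρ)
    (hθ : θ ∈ Icc (0 : ℝ) 1) : ‖AffineMap.lineMap x y θ‖ₑ ≤ ρ := by
  induction ρ with
  | top => exact le_top
  | coe ρ =>
    rw [enorm_le_coe, ← NNReal.coe_le_coe, coe_nnnorm, ← mem_closedBall_zero_iff] at *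
    exact (convex_closedBall 0 _).lineMap_mem hx hy hθ

lemma enorm_four_point_le {f g : E → F} (hf : Differentiable ℝ f) (hg : Differentiable ℝ g)
    {M K : ℝ≥0∞} (hM : M ≠ ∞) (hK : K ≠ ∞) {x₁ x₂ y₁ y₂ : E}
    (hgM : ∀ x, ‖fderiv ℝ g x‖ₑ ≤ M)
    (hfg : ∀ θ ∈ Icc (0 : ℝ) 1, ‖fderiv ℝ f (AffineMap.lineMap y₁ x₁ θ) -
      fderiv ℝ g (AffineMap.lineMap y₂ x₂ θ)‖ₑ ≤ K) :
    ‖(f x₁ - f y₁) - (g x₂ - g y₂)‖ₑ ≤ M * ‖(x₁ - y₁) - (x₂ - y₂)‖ₑ + K * ‖x₁ - y₁‖ₑ := by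
  set B := M * ‖(x₁ - y₁) - (x₂ - y₂)‖ₑ + K * ‖x₁ - y₁‖ₑ
  have hB : B ≠ ∞ := by finiteness
  set p : ℝ →ᵃ[ℝ] E := AffineMap.lineMap y₁ x₁
  set q : ℝ →ᵃ[ℝ] E := AffineMap.lineMap y₂ x₂
  have hderiv : ∀ θ, HasDerivAt (fun θ => f (p θ) - g (q θ))
      (fderiv ℝ f (p θ) (x₁ - y₁) - fderiv ℝ g (q θ) (x₂ - y₂)) θ := fun θ =>
    ((hf (p θ)).hasFDerivAt.comp_hasDerivAt θ AffineMap.hasDerivAt_lineMap).sub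
      ((hg (q θ)).hasFDerivAt.comp_hasDerivAt θ AffineMap.hasDerivAt_lineMap)
  have hbound : ∀ θ ∈ Ico (0 : ℝ) 1,
      ‖fderiv ℝ f (p θ) (x₁ - y₁) - fderiv ℝ g (q θ) (x₂ - y₂)‖ ≤ B.toReal := by
    intro θ hθ
    have hsplit : fderiv ℝ f (p θ) (x₁ - y₁) - fderiv ℝ g (q θ) (x₂ - y₂) =
        fderiv ℝ g (q θ) ((x₁ - y₁) - (x₂ - y₂)) +
          (fderiv ℝ f (p θ) - fderiv ℝ g (q θ)) (x₁ - y₁) := by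
      rw [map_sub _ (x₁ - y₁), sub_apply]
      abel
    rw [hsplit, ← toReal_enorm]
    refine ENNReal.toReal_mono hB ((enorm_add_le _ _).trans (add_le_add ?_ ?_))
    · exact (ContinuousLinearMap.le_opENorm _ _).trans (mul_le_mul_left (hgM _) _)
    · exact (ContinuousLinearMap.le_opENorm _ _).trans
        (mul_le_mul_left (hfg θ (Ico_subset_Icc_self hθ)) _)
  have hmean := norm_image_sub_le_of_norm_deriv_le_segment_01'
    (fun θ _ => (hderiv θ).hasDerivWithinAt) hbound
  simp only [p, q, AffineMap.lineMap_apply_one, AffineMap.lineMap_apply_zero] at hmean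
  rw [sub_sub_sub_comm]
  rwa [← toReal_enorm, ENNReal.toReal_le_toReal enorm_ne_top hB] at hmean

lemma norm_le_card_mul_of_forall_single {ι : Type*} [Fintype ι] [DecidableEq ι]
    {L : EuclideanSpace ℝ ι →L[ℝ] F} {K : ℝ}
    (h : ∀ i, ‖L (EuclideanSpace.single i 1)‖ ≤ K) : ‖L‖ ≤ Fintype.card ι * K := by
  have hK : 0 ≤ Fintype.card ι * K := by
    rw [← nsmul_eq_mul, ← Finset.card_univ]
    simpa using Finset.sum_nonneg fun i (_ : i ∈ Finset.univ) => (norm_nonneg _).trans (h i)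
  refine L.opNorm_le_bound hK fun v => ?_
  have hv : L v = ∑ i, v i • L (EuclideanSpace.single i 1) := by
    conv_lhs => rw [← (EuclideanSpace.basisFun ι ℝ).sum_repr v]
    simp
  calc ‖L v‖ ≤ ∑ i, ‖v i • L (EuclideanSpace.single i 1)‖ := hv ▸ norm_sum_le _ _
    _ ≤ ∑ _ : ι, ‖v‖ * K := by
        gcongr with i
        rw [norm_smul]
        exact mul_le_mul (PiLp.norm_apply_le v i) (h i) (norm_nonneg _) (norm_nonneg _)
    _ = _ := by
        simp only [Finset.sum_const, Finset.card_univ, nsmul_eq_mul]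
        ring

end FourPoint

section Coefficient

variable {d m : ℕ} {T β δ α l u : ℝ} {N H : ℝ≥0∞}
  {σ : ℝ → EuclideanSpace ℝ (Fin d) → EuclideanSpace ℝ (Fin d × Fin m)}

lemma HypH1.measOn_comp (hσ : HypH1 T β δ σ) {y : ℝ → EuclideanSpace ℝ (Fin d)}
    (hy : MeasOn 0 T y) : MeasOn 0 T (fun s => σ s (y s)) :=
  hσ.1.comp (measurable_id.prodMk hy)

lemma HypH1.exists_lipschitzWith (hσ : HypH1 T β δ σ) :
    ∃ M, ∀ t ∈ Icc 0 T, LipschitzWith M (σ t) := by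
  obtain ⟨-, -, M, -, hlip, -, -⟩ := hσ
  refine ⟨(M 0).toNNReal, fun t ht => LipschitzWith.of_dist_le_mul fun x y => ?_⟩
  rw [dist_eq_norm, dist_eq_norm]
  exact (hlip t ht x y).trans (mul_le_mul_of_nonneg_right (Real.le_coe_toNNReal _) (norm_nonneg _))

lemma HypH1.exists_enorm_sub_le (hσ : HypH1 T β δ σ) :
    ∃ M ≠ ∞, ∀ t ∈ Icc 0 T, ∀ s ∈ Icc 0 T, ∀ x y,
      ‖σ t x - σ s y‖ₑ ≤ M * ‖x - y‖ₑ + M * epow |t - s| β := by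
  obtain ⟨-, -, M, hM, hlip, -, htime⟩ := hσ
  have hM₀ := (hM 0 le_rfl).le
  refine ⟨ENNReal.ofReal (M 0), ENNReal.ofReal_ne_top, fun t ht s hs x y => ?_⟩
  have hpow : 0 ≤ |t - s| ^ β := Real.rpow_nonneg (abs_nonneg _) β
  have htime' : ‖σ t x - σ s x‖ ≤ M 0 * |t - s| ^ β := by
    rcases isEmpty_or_nonempty (Fin d) with _ | ⟨⟨i⟩⟩
    · rw [Subsingleton.elim (σ t x) (σ s x), sub_self, norm_zero]
      exact mul_nonneg hM₀ hpow
    · exact (le_add_of_nonneg_right (norm_nonneg _)).trans (htime t ht s hs x i)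
  rw [epow, ← ofReal_norm, ← ofReal_norm, ← ENNReal.ofReal_mul hM₀, ← ENNReal.ofReal_mul hM₀,
    ← ENNReal.ofReal_add (mul_nonneg hM₀ (norm_nonneg _)) (mul_nonneg hM₀ hpow)]
  refine ENNReal.ofReal_le_ofReal ((norm_sub_le_norm_sub_add_norm_sub _ (σ s x) _).trans ?_)
  rw [add_comm]
  exact add_le_add (hlip s hs x y) htime'

lemma HypH1.exists_enorm_fderiv_sub_le (hσ : HypH1 T β δ σ) (hδ : 0 ≤ δ) (hN : N ≠ ∞) :
    ∃ K ≠ ∞, ∀ t ∈ Icc 0 T, ∀ s ∈ Icc 0 T, ∀ x y, ‖x‖ₑ ≤ N → ‖y‖ₑ ≤ N →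
      ‖fderiv ℝ (σ t) x - fderiv ℝ (σ s) y‖ₑ ≤ K * (epow |t - s| β + ‖x - y‖ₑ ^ δ) := by
  obtain ⟨-, -, M, hM, -, hspace, htime⟩ := hσ
  lift N to NNReal using hN
  have hM₀ := (hM 0 le_rfl).le
  have hMN := (hM N N.2).le
  refine ⟨ENNReal.ofReal (d * (M 0 + M N)), ENNReal.ofReal_ne_top,
    fun t ht s hs x y hx hy => ?_⟩
  rw [enorm_le_coe, ← NNReal.coe_le_coe, coe_nnnorm] at hx hy
  have ht₀ : 0 ≤ |t - s| ^ β := Real.rpow_nonneg (abs_nonneg _) β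
  have hx₀ : 0 ≤ ‖x - y‖ ^ δ := Real.rpow_nonneg (norm_nonneg _) δ
  have hpartial : ∀ i, ‖(fderiv ℝ (σ t) x - fderiv ℝ (σ s) y) (EuclideanSpace.single i 1)‖ ≤
      (M 0 + M N) * (|t - s| ^ β + ‖x - y‖ ^ δ) := fun i => calc
    _ ≤ ‖partialX σ i t x - partialX σ i s x‖ + ‖partialX σ i s x - partialX σ i s y‖ :=
        norm_sub_le_norm_sub_add_norm_sub ..
    _ ≤ M 0 * |t - s| ^ β + M N * ‖x - y‖ ^ δ :=
        add_le_add ((le_add_of_nonneg_left (norm_nonneg _)).trans (htime t ht s hs x i))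
          (hspace N N.2 s hs x y hx hy i)
    _ ≤ _ := by nlinarith
  have hnorm := norm_le_card_mul_of_forall_single hpartial
  rw [Fintype.card_fin, ← mul_assoc] at hnorm
  rw [epow, ← ofReal_norm, ← ofReal_norm, ENNReal.ofReal_rpow_of_nonneg (norm_nonneg _) hδ,
    ← ENNReal.ofReal_add ht₀ hx₀, ← ENNReal.ofReal_mul (by positivity)]
  exact ENNReal.ofReal_le_ofReal hnorm

lemma HypH1.exists_four_point_le (hσ : HypH1 T β δ σ) (hδ : 0 ≤ δ) (hN : N ≠ ∞) :
    ∃ K ≠ ∞, ∀ t ∈ Icc 0 T, ∀ s ∈ Icc 0 T, ∀ x₁ x₂ y₁ y₂ : EuclideanSpace ℝ (Fin d),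
      ‖x₁‖ₑ ≤ N → ‖x₂‖ₑ ≤ N → ‖y₁‖ₑ ≤ N → ‖y₂‖ₑ ≤ N →
      ∀ ρ ≠ ∞, ‖x₁ - x₂‖ₑ ≤ ρ → ‖y₁ - y₂‖ₑ ≤ ρ →
        ‖(σ t x₁ - σ t y₁) - (σ s x₂ - σ s y₂)‖ₑ ≤
          K * ‖(x₁ - y₁) - (x₂ - y₂)‖ₑ + K * (epow |t - s| β + ρ ^ δ) * ‖x₁ - y₁‖ₑ := by
  obtain ⟨M, hM⟩ := hσ.exists_lipschitzWith
  obtain ⟨K, hK, hder⟩ := hσ.exists_enorm_fderiv_sub_le hδ hN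
  refine ⟨M + K, by finiteness, ?_⟩
  intro t ht s hs x₁ x₂ y₁ y₂ hx₁ hx₂ hy₁ hy₂ ρ hρ hx hy
  refine (enorm_four_point_le (hσ.2.1 t ht) (hσ.2.1 s hs) (M := M)
    (K := K * (epow |t - s| β + ρ ^ δ)) ENNReal.coe_ne_top ?_ ?_ fun θ hθ => ?_).trans ?_
  · have := epow_ne_top (x := |t - s|) (p := β)
    finiteness
  · exact fun x => enorm_le_coe.2 (norm_fderiv_le_of_lipschitz ℝ (hM s hs))
  · refine (hder t ht s hs _ _ (enorm_lineMap_le hy₁ hx₁ hθ) (enorm_lineMap_le hy₂ hx₂ hθ)).trans ?_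
    gcongr
    rw [← vsub_eq_sub, AffineMap.lineMap_vsub_lineMap]
    exact enorm_lineMap_le hy hx hθ
  · gcongr
    · exact le_self_add
    · exact le_add_self

/-- A bound of the integrals `∫_0^u (u-s)^{κ-α-1} ds` over `u ∈ [0,T]`. -/
def incIntBound (α T κ : ℝ) : ℝ≥0∞ := ENNReal.ofReal (κ - α)⁻¹ * epow T (κ - α)

lemma incIntBound_ne_top (α T κ : ℝ) : incIntBound α T κ ≠ ∞ :=
  ENNReal.mul_ne_top ENNReal.ofReal_ne_top epow_ne_top

lemma setLIntegral_epow_mul_epow_le_incIntBound {κ : ℝ} (hκ : α < κ) (hu : u ∈ Icc 0 T) :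
    ∫⁻ s in Ioo 0 u, epow (u - s) κ * epow (u - s) (-(α + 1)) ≤ incIntBound α T κ := by
  have hint := setLIntegral_epow_sub_left hu.1 (p := 1 - (κ - α)) (by linarith)
  rw [sub_sub_cancel, sub_zero] at hint
  calc _ = ∫⁻ s in Ioo 0 u, epow (u - s) (-(1 - (κ - α))) := by
        refine setLIntegral_congr_fun measurableSet_Ioo fun s hs => ?_
        rw [epow_mul_epow (sub_pos.2 hs.2)]
        congr 1
        ring
    _ = ENNReal.ofReal (κ - α)⁻¹ * epow u (κ - α) := hint
    _ ≤ _ := mul_le_mul_right (epow_le_epow hu.1 hu.2 (by linarith)) _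

/-- `f` is `l`-Hölder continuous on `[a,b]` with constant `H`. -/
def HolderBound {E : Type*} [NormedAddCommGroup E] (l a b : ℝ) (H : ℝ≥0∞) (f : ℝ → E) : Prop :=
  ∀ ⦃s t⦄, a ≤ s → s < t → t ≤ b → ‖f t - f s‖ₑ ≤ H * epow (t - s) l

lemma HypH1.exists_wPt_comp_le (hσ : HypH1 T β δ σ) (hβ₀ : 0 ≤ β) (hβ : α < β) :
    ∃ K ≠ ∞, ∀ y : ℝ → EuclideanSpace ℝ (Fin d), ∀ u ∈ Icc 0 T,
      wPt α 0 (fun s => σ s (y s)) u ≤ K * (1 + wPt α 0 y u) := by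
  obtain ⟨M, hM, hsub⟩ := hσ.exists_enorm_sub_le
  have hB : incIntBound α T β ≠ ∞ := incIntBound_ne_top α T β
  have hT : epow T β ≠ ∞ := epow_ne_top
  set a := ‖σ 0 0‖ₑ + M * epow T β
  refine ⟨a + M * incIntBound α T β + M, by finiteness, fun y u hu => ?_⟩
  have hvalue : ‖σ u (y u)‖ₑ ≤ a + M * ‖y u‖ₑ := by
    have h := hsub u hu 0 ⟨le_rfl, hu.1.trans hu.2⟩ (y u) 0
    rw [sub_zero, sub_zero, abs_of_nonneg hu.1] at h
    calc ‖σ u (y u)‖ₑ = ‖σ 0 0 + (σ u (y u) - σ 0 0)‖ₑ := by rw [add_sub_cancel]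
      _ ≤ ‖σ 0 0‖ₑ + (M * ‖y u‖ₑ + M * epow T β) := (enorm_add_le _ _).trans <| by
          gcongr
          exact h.trans (by gcongr; exact epow_le_epow hu.1 hu.2 hβ₀)
      _ = _ := by ring
  have hincr : ∀ s ∈ Ioo 0 u,
      ‖σ u (y u) - σ s (y s)‖ₑ ≤ M * ‖y u - y s‖ₑ + M * epow (u - s) β := fun s hs => by
    have h := hsub u hu s ⟨hs.1.le, hs.2.le.trans hu.2⟩ (y u) (y s)
    rwa [abs_of_pos (sub_pos.2 hs.2)] at h
  calc _ ≤ a + M * ‖y u‖ₑ + (M * incInt α 0 y u + M * incIntBound α T β) := by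
        refine (wPt_le_of_enorm_sub_le (ω := fun τ => M * epow τ β) hM (by fun_prop) hincr).trans ?_
        simp only [mul_assoc, lintegral_const_mul' _ _ hM]
        gcongr
        exact setLIntegral_epow_mul_epow_le_incIntBound hβ hu
    _ = (a + M * incIntBound α T β) * 1 + M * wPt α 0 y u := by
        rw [wPt]
        ring
    _ ≤ _ := by
        rw [mul_add]
        exact add_le_add (mul_le_mul_left le_self_add _) (mul_le_mul_left le_add_self _)

lemma HypH1.exists_wPt_comp_sub_le (hσ : HypH1 T β δ σ) (hδ : 0 ≤ δ) (hβ : α < β)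
    (hl : α < l * δ) (hN : N ≠ ∞) (hH : H ≠ ∞) :
    ∃ K ≠ ∞, ∀ y y' : ℝ → EuclideanSpace ℝ (Fin d),
      (∀ u ∈ Icc 0 T, ‖y u‖ₑ ≤ N) → (∀ u ∈ Icc 0 T, ‖y' u‖ₑ ≤ N) →
      HolderBound l 0 T H y → HolderBound l 0 T H y' → ∀ u ∈ Icc 0 T,
        wPt α 0 (fun s => σ s (y s) - σ s (y' s)) u ≤ K * wPt α 0 (fun s => y s - y' s) u := by
  obtain ⟨M, hM⟩ := hσ.exists_lipschitzWith
  obtain ⟨K, hK, hfour⟩ := hσ.exists_four_point_le hδ hN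
  set B := incIntBound α T β + H ^ δ * incIntBound α T (l * δ)
  have hB : B ≠ ∞ := by finiteness [incIntBound_ne_top α T β, incIntBound_ne_top α T (l * δ)]
  refine ⟨M + K * B + K, by finiteness, fun y y' hy hy' hHy hHy' u hu => ?_⟩
  set D := ‖y u - y' u‖ₑ
  have hincr : ∀ s ∈ Ioo 0 u, ‖(σ u (y u) - σ u (y' u)) - (σ s (y s) - σ s (y' s))‖ₑ ≤
      K * ‖(y u - y' u) - (y s - y' s)‖ₑ +
        K * (epow (u - s) β + H ^ δ * epow (u - s) (l * δ)) * D := fun s hs => by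
    have hsu := sub_pos.2 hs.2
    have hsT : s ∈ Icc 0 T := ⟨hs.1.le, hs.2.le.trans hu.2⟩
    have h := hfour u hu s hsT _ _ _ _ (hy u hu) (hy s hsT) (hy' u hu) (hy' s hsT) _
      (ENNReal.mul_ne_top hH epow_ne_top) (hHy hs.1.le hs.2 hu.2) (hHy' hs.1.le hs.2 hu.2)
    rwa [ENNReal.mul_rpow_of_nonneg _ _ hδ, epow_rpow hsu.le hδ, abs_of_pos hsu] at h
  have hmodulus : ∫⁻ s in Ioo 0 u, K * (epow (u - s) β + H ^ δ * epow (u - s) (l * δ)) * D *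
      epow (u - s) (-(α + 1)) ≤ K * B * D := by
    calc _ = K * (∫⁻ s in Ioo 0 u, (epow (u - s) β * epow (u - s) (-(α + 1)) +
          H ^ δ * (epow (u - s) (l * δ) * epow (u - s) (-(α + 1))))) * D := by
          rw [← lintegral_const_mul' _ _ hK, ← lintegral_mul_const' _ _ enorm_ne_top]
          exact lintegral_congr fun s => by ring
      _ ≤ _ := by
          rw [lintegral_add_left (by fun_prop), lintegral_const_mul _ (by fun_prop)]
          gcongr
          exact add_le_add (setLIntegral_epow_mul_epow_le_incIntBound hβ hu)
            (mul_le_mul_right (setLIntegral_epow_mul_epow_le_incIntBound hl hu) _)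
  calc _ ≤ M * D + (K * incInt α 0 (fun s => y s - y' s) u + K * B * D) := by
        refine (wPt_le_of_enorm_sub_le (g := fun s => y s - y' s)
          (ω := fun τ => K * (epow τ β + H ^ δ * epow τ (l * δ)) * D) hK (by fun_prop)
          hincr).trans (add_le_add ?_ (add_le_add le_rfl hmodulus))
        simpa only [edist_eq_enorm_sub] using hM u hu (y u) (y' u)
    _ = (M + K * B) * D + K * incInt α 0 (fun s => y s - y' s) u := by ring
    _ ≤ (M + K * B + K) * D + (M + K * B + K) * incInt α 0 (fun s => y s - y' s) u := by
        gcongr ?_ * _ + ?_ * _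
        exacts [le_self_add, le_add_self]
    _ = _ := (mul_add _ _ _).symm

end Coefficient

section Delay

variable {E : Type*} [NormedAddCommGroup E] {α l θ a b T r r₀ s u : ℝ} {H : ℝ≥0∞} {z : ℝ → E}

lemma wPt_shift : wPt α 0 (fun s => z (s - r)) u = wPt α (-r) z (u - r) := by
  unfold wPt incInt
  rw [← zero_sub r, ← setLIntegral_Ioo_sub_right
    (fun s => ‖z (u - r) - z s‖ₑ * epow (u - r - s) (-(α + 1)))]
  simp only [sub_sub_sub_cancel_right]

lemma HolderBound.shift (hz : HolderBound l a b H z) :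
    HolderBound l (a + r) (b + r) H (fun s => z (s - r)) := fun s t hs hst ht => by
  simpa using hz (le_sub_iff_add_le.2 hs) (sub_lt_sub_right hst r) (sub_le_iff_le_add.2 ht)

lemma HolderBound.mono {a' b' : ℝ} {H' : ℝ≥0∞} (hz : HolderBound l a b H z) (ha : a ≤ a')
    (hb : b' ≤ b) (hH : H ≤ H') : HolderBound l a' b' H' z :=
  fun _ _ hs hst ht => (hz (ha.trans hs) hst (ht.trans hb)).trans (mul_le_mul_left hH _)

-- The Hölder bound is applied across the delay if `r ≤ u - s`, and across the time step otherwise.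
lemma HolderBound.enorm_delay_sub_le (hz : HolderBound l (-r) T H z) (hr : 0 < r) (hθ₀ : 0 ≤ θ)
    (hθ : θ ≤ l) (hs : 0 ≤ s) (hsu : s < u) (hu : u ≤ T) :
    ‖(z u - z (u - r)) - (z s - z (s - r))‖ₑ ≤
      2 * H * epow r (l - θ) * epow (u - s) θ := by
  have hsub : 0 < u - s := sub_pos.2 hsu
  have hsplit : ∀ {τ}, 0 < τ → epow τ l = epow τ (l - θ) * epow τ θ := fun hτ => by
    rw [epow_mul_epow hτ, sub_add_cancel]
  rw [mul_assoc, mul_assoc, two_mul, ← mul_assoc]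
  rcases le_total r (u - s) with h | h
  · have hstep : ∀ v, 0 ≤ v → v ≤ T → ‖z v - z (v - r)‖ₑ ≤ H * epow r (l - θ) * epow (u - s) θ :=
      fun v hv hvT => by
        have := hz (by linarith : -r ≤ v - r) (by linarith) hvT
        rw [sub_sub_cancel, hsplit hr, ← mul_assoc] at this
        exact this.trans (by gcongr; exact epow_le_epow hr.le h hθ₀)
    exact enorm_sub_le.trans
      (add_le_add (hstep u (hs.trans hsu.le) hu) (hstep s hs (hsu.le.trans hu)))
  · have hstep : ∀ v w, -r ≤ v → w ≤ T → w - v = u - s →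
        ‖z w - z v‖ₑ ≤ H * epow r (l - θ) * epow (u - s) θ := fun v w hv hw hvw => by
      have := hz hv (by linarith) hw
      rw [hvw, hsplit hsub, ← mul_assoc] at this
      exact this.trans (by gcongr; exact epow_le_epow hsub.le h (sub_nonneg.2 hθ))
    rw [sub_sub_sub_comm]
    exact enorm_sub_le.trans (add_le_add (hstep s u (by linarith) hu rfl)
      (hstep (s - r) (u - r) (by linarith) (by linarith) (by ring)))

lemma HolderBound.wPt_delay_le (hz : HolderBound l (-r) T H z) (hH : H ≠ ∞) (hr : r ∈ Ioc 0 r₀)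
    (hθ₀ : 0 ≤ θ) (hαθ : α < θ) (hθ : θ ≤ l) (hu : u ∈ Icc 0 T) :
    wPt α 0 (fun s => z s - z (s - r)) u ≤
      (H * epow r₀ θ + 2 * H * incIntBound α T θ) * epow r (l - θ) := by
  have hvalue : ‖z u - z (u - r)‖ₑ ≤ H * epow r₀ θ * epow r (l - θ) := by
    have h := hz (by linarith [hu.1] : -r ≤ u - r) (by linarith [hr.1]) hu.2
    rw [sub_sub_cancel, ← add_sub_cancel θ l, ← epow_mul_epow hr.1, ← mul_assoc] at h
    exact h.trans (by gcongr; exact epow_le_epow hr.1.le hr.2 hθ₀)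
  refine (wPt_le_of_enorm_sub_le (g := z) (m := 0)
    (ω := fun τ => 2 * H * epow r (l - θ) * epow τ θ) ENNReal.zero_ne_top (by fun_prop)
    fun s hs => ?_).trans ?_
  · rw [zero_mul, zero_add]
    exact hz.enorm_delay_sub_le hr.1 hθ₀ hθ hs.1.le hs.2 hu.2
  · have hconst : 2 * H * epow r (l - θ) ≠ ∞ := by finiteness [epow_ne_top (x := r) (p := l - θ)]
    simp only [mul_assoc (2 * H * epow r (l - θ))]
    rw [zero_mul, zero_add, lintegral_const_mul' _ _ hconst, add_mul,
      mul_right_comm _ (incIntBound α T θ)]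
    gcongr
    exact setLIntegral_epow_mul_epow_le_incIntBound hαθ hu

end Delay

section FunctionSpaces

variable {E : Type*} [NormedAddCommGroup E] {α l a b c r T : ℝ} {H₁ H₂ : ℝ≥0∞} {f f' : ℝ → E}

lemma HolderBound.congr (hf : HolderBound l a b H₁ f) (h : EqOn f' f (Icc a b)) :
    HolderBound l a b H₁ f' := fun s t hs hst ht => by
  rw [h ⟨hs, hst.le.trans ht⟩, h ⟨hs.trans hst.le, ht⟩]
  exact hf hs hst ht

lemma HolderBound.union (hl : 0 ≤ l) (hf : HolderBound l a b H₁ f) (hf' : HolderBound l b c H₂ f) :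
    HolderBound l a c (H₁ + H₂) f := by
  intro s t hs hst ht
  rcases le_or_gt t b with htb | hbt
  · exact (hf hs hst htb).trans (mul_le_mul_left le_self_add _)
  rcases le_or_gt b s with hbs | hsb
  · exact (hf' hbs hst ht).trans (mul_le_mul_left le_add_self _)
  calc ‖f t - f s‖ₑ = ‖(f b - f s) + (f t - f b)‖ₑ := by rw [add_comm, sub_add_sub_cancel]
    _ ≤ H₁ * epow (b - s) l + H₂ * epow (t - b) l :=
        (enorm_add_le _ _).trans (add_le_add (hf hs hsb le_rfl) (hf' le_rfl hbt ht))
    _ ≤ H₁ * epow (t - s) l + H₂ * epow (t - s) l := by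
        gcongr <;> exact epow_le_epow (by linarith) (by linarith) hl
    _ = _ := (add_mul _ _ _).symm

lemma holderBound_holderNorm (f : ℝ → E) : HolderBound l a b (holderNorm l a b f) f := by
  intro s t hs hst ht
  rw [← mul_epow_neg_le_iff (sub_pos.2 hst), ← ofReal_norm_div_rpow _ (sub_pos.2 hst)]
  refine le_trans ?_ le_add_self
  exact (le_iSup₂ (f := fun t (_ : t ∈ Ioc s b) => ENNReal.ofReal (‖f t - f s‖ / (t - s) ^ l)) t
    ⟨hst, ht⟩).trans (le_iSup₂ (f := fun s (_ : s ∈ Icc a b) => ⨆ t ∈ Ioc s b,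
      ENNReal.ofReal (‖f t - f s‖ / (t - s) ^ l)) s ⟨hs, (hst.trans_le ht).le⟩)

lemma IncrementBound.holderBound {c C K : ℝ≥0∞} {Ψ : ℝ → ℝ≥0∞} (hα : 0 < α) (hα' : α < 1)
    (hf : IncrementBound α T c C Ψ f) (hK : K ≠ ∞) (hΨ : ∀ u ∈ Icc 0 T, Ψ u ≤ K) :
    HolderBound (1 - α) 0 T
      (c + C * K * (ENNReal.ofReal (1 - α)⁻¹ + betaBound (1 - α) α)) f := by
  intro s t hs hst ht
  refine (hf.mono (Ψ' := 1) hK (fun u hu => by simpa using hΨ u hu) hs hst ht).trans ?_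
  rw [add_mul, mul_assoc (C * K)]
  gcongr
  exact potential_one_le hα hα' hs hst

lemma wPt_le_wPt_of_le {u : ℝ} (hab : a ≤ b) : wPt α b f u ≤ wPt α a f u :=
  add_le_add le_rfl (lintegral_mono_set (Ioo_subset_Ioo_left hab))

lemma wPt_eq_of_eqOn {u : ℝ} (hu : a ≤ u) (h : EqOn f f' (Icc a u)) :
    wPt α a f u = wPt α a f' u := by
  rw [wPt, wPt, h ⟨hu, le_rfl⟩, incInt_congr (h.mono Ioc_subset_Icc_self)]

lemma wPt_neg {t : ℝ} : wPt α a (fun s => -f s) t = wPt α a f t := by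
  simp only [wPt, incInt, ← neg_sub', enorm_neg]

lemma incInt_le_add_incInt {v : ℝ} (hα : 0 < α) (hab : a ≤ b) (hbv : b < v) :
    incInt α a f v ≤ incInt α a f b + ENNReal.ofReal α⁻¹ * (epow (v - b) (-α) * ‖f v - f b‖ₑ) +
      incInt α b f v := by
  have hhistory : ∫⁻ s in Ioo a b, ‖f v - f s‖ₑ * epow (v - s) (-(α + 1)) ≤
      incInt α a f b + ENNReal.ofReal α⁻¹ * (epow (v - b) (-α) * ‖f v - f b‖ₑ) := by
    calc _ ≤ ∫⁻ s in Ioo a b, (‖f b - f s‖ₑ * epow (b - s) (-(α + 1)) +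
          epow (v - s) (-(α + 1)) * ‖f v - f b‖ₑ) := by
          refine setLIntegral_mono' measurableSet_Ioo fun s hs => ?_
          rw [← sub_add_sub_cancel' (f b) (f s) (f v), mul_comm _ ‖f v - f b‖ₑ]
          refine (mul_le_mul_left (enorm_add_le _ _) _).trans ?_
          rw [add_mul]
          gcongr
          exact epow_le_epow_of_nonpos (by linarith [hs.2]) (by linarith) (by linarith)
      _ ≤ _ := by
          rw [lintegral_add_right _ (by fun_prop), lintegral_mul_const _ (by fun_prop), ← mul_assoc]
          gcongr
          · exact le_rfl
          · exact setLIntegral_epow_tail_left_le hbv hα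
  have hunion : Ioc a v = Ioc a b ∪ Ioc b v := (Ioc_union_Ioc_eq_Ioc hab hbv.le).symm
  have hsplit : incInt α a f v ≤
      (∫⁻ s in Ioo a b, ‖f v - f s‖ₑ * epow (v - s) (-(α + 1))) + incInt α b f v := by
    simp only [incInt, restrict_Ioo_eq_restrict_Ioc, hunion]
    exact lintegral_union_le _ _ _
  exact hsplit.trans (add_le_add hhistory le_rfl)

lemma wPt_le_wPt_zero_add_startNorm {v : ℝ} (hα : 0 < α) (ha : a ≤ 0) (hv : 0 ≤ v) :
    wPt α a f v ≤ wPt α a f 0 + (1 + ENNReal.ofReal α⁻¹) * startNorm α f v := by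
  rcases hv.eq_or_lt with rfl | hv
  · exact le_self_add
  set n := ‖f v - f 0‖ₑ
  have hvalue : ‖f v‖ₑ ≤ ‖f 0‖ₑ + n := by simpa using enorm_add_le (f 0) (f v - f 0)
  have hincr := incInt_le_add_incInt (f := f) hα ha hv
  rw [sub_zero] at hincr
  calc wPt α a f v ≤ ‖f 0‖ₑ + n +
        (incInt α a f 0 + ENNReal.ofReal α⁻¹ * (epow v (-α) * n) + incInt α 0 f v) :=
        add_le_add hvalue hincr
    _ = wPt α a f 0 + (n + ENNReal.ofReal α⁻¹ * (epow v (-α) * n) + incInt α 0 f v) := by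
        rw [wPt]
        ring
    _ ≤ wPt α a f 0 + (n + ENNReal.ofReal α⁻¹ * (epow v (-α) * n) + incInt α 0 f v +
          (ENNReal.ofReal α⁻¹ * (n + incInt α 0 f v) + epow v (-α) * n)) :=
        add_le_add le_rfl le_self_add
    _ = _ := by
        rw [startNorm]
        ring

variable [MeasurableSpace E]

lemma MemW.mono_left (hf : MemW α a c f) (hab : a ≤ b) : MemW α b c f := by
  refine ⟨hf.1.mono hab le_rfl, lt_of_le_of_lt ?_ hf.2⟩
  rw [wNorm_eq_iSup_wPt]
  exact iSup₂_le fun t ht => (wPt_le_wPt_of_le hab).trans (wPt_le_wNorm ⟨hab.trans ht.1, ht.2⟩)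

lemma MemW.shift (hr : 0 ≤ r) (hf : MemW α (-r) T f) : MemW α 0 T (fun s => f (s - r)) := by
  have hmem : ∀ t ∈ Icc 0 T, t - r ∈ Icc (-r) T :=
    fun t ht => ⟨by linarith [ht.1], by linarith [ht.2]⟩
  refine ⟨Measurable.comp (g := fun t : Icc (-r) T => f t) hf.1
    ((measurable_subtype_coe.sub_const r).subtype_mk (h := fun t => hmem t t.2)),
    lt_of_le_of_lt ?_ hf.2⟩
  rw [wNorm_eq_iSup_wPt]
  refine iSup₂_le fun t ht => ?_
  rw [wPt_shift]
  exact wPt_le_wNorm (hmem t ht)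

variable [BorelSpace E] [SecondCountableTopology E]

lemma wPt_sub_le {t : ℝ} (hf : MeasOn a b f) (ht : t ∈ Icc a b) :
    wPt α a (fun s => f s - f' s) t ≤ wPt α a f t + wPt α a f' t := by
  simpa only [sub_eq_add_neg, wPt_neg] using wPt_add_le (f' := fun s => -f' s) hf ht

lemma MemW.sub (hf : MemW α a b f) (hf' : MemW α a b f') : MemW α a b (fun s => f s - f' s) := by
  refine ⟨Measurable.sub (f := fun t : Icc a b => f t) hf.1 hf'.1,
    lt_of_le_of_lt ?_ (ENNReal.add_lt_top.2 ⟨hf.2, hf'.2⟩)⟩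
  rw [wNorm_eq_iSup_wPt]
  exact iSup₂_le fun t ht =>
    (wPt_sub_le hf.1 ht).trans (add_le_add (wPt_le_wNorm ht) (wPt_le_wNorm ht))

end FunctionSpaces

section Drift

variable {E : Type*} [NormedAddCommGroup E] {α s t T : ℝ} {l c C : ℝ≥0∞} {Ψ : ℝ → ℝ≥0∞}

lemma setLIntegral_enorm_le_eLpNorm_mul_epow {q : ℝ → E} (hα : 0 < α) (hα' : α ≤ 1)
    (hq : AEStronglyMeasurable q (volume.restrict (Icc 0 T))) (hs : 0 ≤ s) (hst : s < t)
    (ht : t ≤ T) :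
    ∫⁻ u in Ioo s t, ‖q u‖ₑ ≤
      eLpNorm q (ENNReal.ofReal (1 / α)) (volume.restrict (Icc 0 T)) * epow (t - s) (1 - α) := by
  have hsub : Ioo s t ⊆ Icc 0 T := fun u hu => ⟨hs.trans hu.1.le, hu.2.le.trans ht⟩
  have hμ : volume.restrict (Ioo s t) ≤ volume.restrict (Icc 0 T) :=
    Measure.restrict_mono hsub le_rfl
  have hp : (1 : ℝ≥0∞) ≤ ENNReal.ofReal (1 / α) :=
    ENNReal.one_le_ofReal.2 ((one_le_div hα).2 hα')
  have holder := eLpNorm_le_eLpNorm_mul_rpow_measure_univ hp (hq.mono_measure hμ)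
  rw [eLpNorm_one_eq_lintegral_enorm, Measure.restrict_apply_univ, Real.volume_Ioo,
    ENNReal.toReal_one, ENNReal.toReal_ofReal (by positivity), one_div_one_div, div_one,
    ENNReal.ofReal_rpow_of_pos (sub_pos.2 hst)] at holder
  exact holder.trans (mul_le_mul_left (eLpNorm_mono_measure _ hμ) _)

lemma setLIntegral_le_epow_mul_potential (hα : 0 ≤ α) (hs : 0 ≤ s) (ht : t ≤ T) :
    ∫⁻ u in Ioo s t, Ψ u ≤ epow T α * potential α s t Ψ := by
  calc ∫⁻ u in Ioo s t, Ψ u ≤ ∫⁻ u in Ioo s t, epow T α * (epow u (-α) * Ψ u) := by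
        refine setLIntegral_mono' measurableSet_Ioo fun u hu => ?_
        have hu0 : 0 < u := hs.trans_lt hu.1
        calc Ψ u = epow u α * (epow u (-α) * Ψ u) := by
              rw [← mul_assoc, epow_mul_epow hu0, add_neg_cancel, epow_zero, one_mul]
          _ ≤ _ := mul_le_mul_left (epow_le_epow hu0.le (hu.2.le.trans ht) hα) _
    _ = epow T α * ∫⁻ u in Ioo s t, epow u (-α) * Ψ u := lintegral_const_mul' _ _ epow_ne_top
    _ ≤ _ := mul_le_mul_right lintegral_epow_le_potential _

lemma incrementBound_intervalIntegral [NormedSpace ℝ E] {F : Type*} [NormedAddCommGroup F]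
    {f : ℝ → E} {q : ℝ → F} (hα : 0 < α) (hα' : α ≤ 1)
    (hq : AEStronglyMeasurable q (volume.restrict (Icc 0 T))) (hl : l ≠ ∞)
    (hf : IntervalIntegrable f volume 0 T) (hfq : ∀ u ∈ Icc 0 T, ‖f u‖ₑ ≤ ‖q u‖ₑ + l * Ψ u) :
    IncrementBound α T (eLpNorm q (ENNReal.ofReal (1 / α)) (volume.restrict (Icc 0 T)))
      (l * epow T α) Ψ (fun t => ∫ u in (0 : ℝ)..t, f u) := by
  intro s t hs hst ht
  have hint : ∀ v ∈ Icc 0 T, IntervalIntegrable f volume 0 v := fun v hv =>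
    hf.mono_set (uIcc_subset_uIcc_left (Icc_subset_uIcc hv))
  have hsub : Ioo s t ⊆ Icc 0 T := fun u hu => ⟨hs.trans hu.1.le, hu.2.le.trans ht⟩
  rw [intervalIntegral.integral_interval_sub_left (hint t ⟨hs.trans hst.le, ht⟩)
    (hint s ⟨hs, hst.le.trans ht⟩)]
  calc _ ≤ ∫⁻ u in Ioo s t, ‖f u‖ₑ := enorm_intervalIntegral_le hst.le f
    _ ≤ ∫⁻ u in Ioo s t, (‖q u‖ₑ + l * Ψ u) :=
        setLIntegral_mono' measurableSet_Ioo fun u hu => hfq u (hsub hu)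
    _ = (∫⁻ u in Ioo s t, ‖q u‖ₑ) + l * ∫⁻ u in Ioo s t, Ψ u := by
        rw [lintegral_add_left' (hq.mono_measure (Measure.restrict_mono hsub le_rfl)).enorm,
          lintegral_const_mul' _ _ hl]
    _ ≤ _ := by
        rw [mul_assoc]
        exact add_le_add (setLIntegral_enorm_le_eLpNorm_mul_epow hα hα' hq hs hst ht)
          (mul_le_mul_right (setLIntegral_le_epow_mul_potential hα.le hs ht) l)

lemma IncrementBound.of_eq_const_add {h h' : ℝ → E} {x₀ : E} (hh : IncrementBound α T c C Ψ h)
    (heq : ∀ t ∈ Icc 0 T, h' t = x₀ + h t) : IncrementBound α T c C Ψ h' := fun s t hs hst ht => by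
  rw [heq t ⟨hs.trans hst.le, ht⟩, heq s ⟨hs, hst.le.trans ht⟩, add_sub_add_left_eq_sub]
  exact hh hs hst ht

variable {d : ℕ} {ρ : ℝ} {N : ℝ≥0∞}
  {b : ℝ → EuclideanSpace ℝ (Fin d) → EuclideanSpace ℝ (Fin d)}

lemma HypH2'.exists_growth (hb : HypH2' T ρ b) :
    ∃ b₀ : ℝ → ℝ, MemLp b₀ (ENNReal.ofReal ρ) (volume.restrict (Icc 0 T)) ∧ ∃ L ≠ ∞,
      ∀ t ∈ Icc 0 T, ∀ x, ‖b t x‖ₑ ≤ ‖b₀ t‖ₑ + L * ‖x‖ₑ := by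
  obtain ⟨-, b₀, L, hb₀, hL, -, hgrowth⟩ := hb
  refine ⟨b₀, hb₀, ENNReal.ofReal (L 0), ENNReal.ofReal_ne_top, fun t ht x => ?_⟩
  have hL₀ : 0 ≤ L 0 := (hL 0 le_rfl).le
  rw [← ofReal_norm, ← ofReal_norm, ← ofReal_norm, ← ENNReal.ofReal_mul hL₀,
    ← ENNReal.ofReal_add (norm_nonneg _) (by positivity)]
  exact ENNReal.ofReal_le_ofReal (by linarith [hgrowth t ht x, Real.le_norm_self (b₀ t)])

lemma HypH2'.exists_enorm_sub_le (hb : HypH2' T ρ b) (hN : N ≠ ∞) :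
    ∃ L ≠ ∞, ∀ t ∈ Icc 0 T, ∀ x y, ‖x‖ₑ ≤ N → ‖y‖ₑ ≤ N → ‖b t x - b t y‖ₑ ≤ L * ‖x - y‖ₑ := by
  obtain ⟨-, -, L, -, hL, hlip, -⟩ := hb
  refine ⟨ENNReal.ofReal (L N.toReal), ENNReal.ofReal_ne_top, fun t ht x y hx hy => ?_⟩
  have hnorm : ∀ v : EuclideanSpace ℝ (Fin d), ‖v‖ₑ ≤ N → ‖v‖ ≤ N.toReal := fun v hv => by
    rwa [← toReal_enorm, ENNReal.toReal_le_toReal enorm_ne_top hN]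
  rw [← ofReal_norm, ← ofReal_norm, ← ENNReal.ofReal_mul (hL _ ENNReal.toReal_nonneg).le]
  exact ENNReal.ofReal_le_ofReal
    (hlip _ ENNReal.toReal_nonneg t ht x y (hnorm x hx) (hnorm y hy))

lemma HypH2'.intervalIntegrable_comp (hb : HypH2' T ρ b) (hρ : 1 ≤ ρ) (hT : 0 ≤ T)
    {z : ℝ → EuclideanSpace ℝ (Fin d)} (hz : MeasOn 0 T z) (hN : N ≠ ∞)
    (hzN : ∀ u ∈ Icc 0 T, ‖z u‖ₑ ≤ N) :
    IntervalIntegrable (fun s => b s (z s)) volume 0 T := by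
  have hmeas : MeasOn 0 T (fun s => b s (z s)) := hb.1.comp (measurable_id.prodMk hz)
  obtain ⟨b₀, hb₀, L, hL, hgrowth⟩ := hb.exists_growth
  have hb₀int : ∫⁻ u in Icc 0 T, ‖b₀ u‖ₑ ≠ ∞ :=
    (hb₀.integrable (ENNReal.one_le_ofReal.2 hρ)).hasFiniteIntegral.ne
  have hvol : volume (Ioo 0 T) ≠ ∞ := measure_Ioo_lt_top.ne
  refine intervalIntegrable_of_lintegral_enorm_ne_top hT
    (hmeas.aestronglyMeasurable le_rfl le_rfl) (ne_top_of_le_ne_top (b :=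
      (∫⁻ u in Icc 0 T, ‖b₀ u‖ₑ) + L * N * volume (Ioo 0 T)) (by finiteness) ?_)
  calc _ ≤ ∫⁻ u in Ioo 0 T, (‖b₀ u‖ₑ + L * N) :=
        setLIntegral_mono' measurableSet_Ioo fun u hu =>
          (hgrowth u (Ioo_subset_Icc_self hu) (z u)).trans
            (add_le_add le_rfl (mul_le_mul_right (hzN u (Ioo_subset_Icc_self hu)) L))
    _ ≤ _ := by
        rw [lintegral_add_right _ measurable_const, setLIntegral_const]
        gcongr
        exact Ioo_subset_Icc_self

end Drift

section DrivenSolutions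

variable {d m : ℕ} {α β δ l r T : ℝ} {N H : ℝ≥0∞}
  {b : ℝ → EuclideanSpace ℝ (Fin d) → EuclideanSpace ℝ (Fin d)}
  {σ : ℝ → EuclideanSpace ℝ (Fin d) → EuclideanSpace ℝ (Fin d × Fin m)}
  {g : ℝ → EuclideanSpace ℝ (Fin m)} {x₀ : EuclideanSpace ℝ (Fin d)}
  {η x y z : ℝ → EuclideanSpace ℝ (Fin d)}

/-- `z` solves the equation `z(t) = x₀ + ∫_0^t b(s,z(s)) ds + ∫_0^t σ(s,y(s)) dg_s` on `[0,T]`, in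
which the diffusion coefficient is evaluated along another path `y`. Both equations of the theorem
are of this form: `y = z` without delay, and `y(s) = z(s-r)` with delay `r`. -/
structure IsDrivenBy (α T : ℝ) (b : ℝ → EuclideanSpace ℝ (Fin d) → EuclideanSpace ℝ (Fin d))
    (σ : ℝ → EuclideanSpace ℝ (Fin d) → EuclideanSpace ℝ (Fin d × Fin m))
    (g : ℝ → EuclideanSpace ℝ (Fin m)) (x₀ : EuclideanSpace ℝ (Fin d))
    (y z : ℝ → EuclideanSpace ℝ (Fin d)) : Prop where
  memW_driver : MemW α 0 T y
  memW : MemW α 0 T z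
  eq_add_integral : ∀ t ∈ Icc 0 T, z t = x₀ + (∫ s in (0 : ℝ)..t, b s (z s)) +
    vecStieltjes α t (fun s => σ s (y s)) g

lemma IsSolution.isDrivenBy (hx : IsSolution α T b σ g x₀ x) : IsDrivenBy α T b σ g x₀ x x :=
  ⟨hx.1, hx.1, hx.2⟩

lemma IsDelaySolution.isDrivenBy (hr : 0 ≤ r) (hz : IsDelaySolution α T r b σ g η z) :
    IsDrivenBy α T b σ g (η 0) (fun s => z (s - r)) z := by
  refine ⟨hz.1.shift hr, hz.1.mono_left (neg_nonpos.2 hr), fun t ht => ?_⟩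
  rcases ht.1.eq_or_lt with rfl | h
  · rw [intervalIntegral.integral_same, vecStieltjes_zero, add_zero, add_zero]
    exact hz.2.2 0 ⟨neg_nonpos.2 hr, le_rfl⟩
  · exact hz.2.1 t ⟨h, ht.2⟩

lemma HypH1.memW_comp (hσ : HypH1 T β δ σ) (hβ₀ : 0 ≤ β) (hβ : α < β) (hy : MemW α 0 T y) :
    MemW α 0 T (fun s => σ s (y s)) := by
  obtain ⟨K, hK, hle⟩ := hσ.exists_wPt_comp_le hβ₀ hβ
  have hfin : K * (1 + wNorm α 0 T y) < ∞ := by finiteness [hy.2.ne]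
  refine ⟨hσ.measOn_comp hy.1, lt_of_le_of_lt ?_ hfin⟩
  rw [wNorm_eq_iSup_wPt]
  exact iSup₂_le fun t ht => (hle y t ht).trans (by gcongr; exact wPt_le_wNorm ht)

lemma IsDrivenBy.intervalIntegrable (hz : IsDrivenBy α T b σ g x₀ y z) (hT : 0 ≤ T) (hα : 0 < α)
    (hα' : α ≤ 1) (hb : HypH2' T (1 / α) b) :
    IntervalIntegrable (fun s => b s (z s)) volume 0 T :=
  hb.intervalIntegrable_comp ((one_le_div hα).2 hα') hT hz.memW.1 hz.memW.2.ne
    fun _ hu => enorm_le_wPt.trans (wPt_le_wNorm hu)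

lemma IsDrivenBy.exists_incrementBound (hT : 0 ≤ T) (hα : 0 < α) (hα' : α < 1) (hβ : α < β)
    (hσ : HypH1 T β δ σ) (hb : HypH2' T (1 / α) b) (hg : MemWT α T g) :
    ∃ c ≠ ∞, ∃ C ≠ ∞, ∀ x₀ y z, IsDrivenBy α T b σ g x₀ y z →
      IncrementBound α T c C (fun u => (1 + wPt α 0 y u) ⊔ ‖z u‖ₑ) z := by
  have hβ₀ : 0 ≤ β := (hα.trans hβ).le
  obtain ⟨K, hK, hle⟩ := hσ.exists_wPt_comp_le hβ₀ hβ
  obtain ⟨b₀, hb₀, L, hL, hgrowth⟩ := hb.exists_growth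
  have hleft : leftBound α T ≠ ∞ := leftBound_ne_top
  have hweyl : weylBound α (wTNorm α T g) ≠ ∞ := weylBound_ne_top hg.2.ne
  have hTα : epow T α ≠ ∞ := epow_ne_top
  refine ⟨eLpNorm b₀ (ENNReal.ofReal (1 / α)) (volume.restrict (Icc 0 T)) + 0,
    by finiteness [hb₀.2.ne], L * epow T α +
      d * (m * (leftBound α T * weylBound α (wTNorm α T g))) * K, by finiteness,
    fun x₀ y z hz => ?_⟩
  have hdrift := incrementBound_intervalIntegral (Ψ := fun u => (1 + wPt α 0 y u) ⊔ ‖z u‖ₑ)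
    hα hα'.le hb₀.1 hL (hz.intervalIntegrable hT hα hα'.le hb) fun u hu =>
      (hgrowth u hu (z u)).trans (add_le_add le_rfl (mul_le_mul_right le_sup_right L))
  have hnoise := (incrementBound_vecStieltjes hα hα' (hσ.memW_comp hβ₀ hβ hz.memW_driver)
    hg).mono (Ψ' := fun u => (1 + wPt α 0 y u) ⊔ ‖z u‖ₑ) hK fun u hu =>
      (hle y u hu).trans (mul_le_mul_right le_sup_left K)
  exact (hdrift.add hnoise).of_eq_const_add fun t ht =>
    (hz.eq_add_integral t ht).trans (add_assoc _ _ _)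

lemma IsDrivenBy.sub_eq (hT : 0 ≤ T) (hα : 0 < α) (hα' : α < 1) (hβ : α < β)
    (hσ : HypH1 T β δ σ) (hb : HypH2' T (1 / α) b) (hg : MemWT α T g)
    {x₀' : EuclideanSpace ℝ (Fin d)} {y' z' : ℝ → EuclideanSpace ℝ (Fin d)}
    (hz : IsDrivenBy α T b σ g x₀ y z) (hz' : IsDrivenBy α T b σ g x₀' y' z') {t : ℝ}
    (ht : t ∈ Icc 0 T) :
    z t - z' t = (x₀ - x₀') + ((∫ s in (0 : ℝ)..t, (b s (z s) - b s (z' s))) +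
      vecStieltjes α t (fun s => σ s (y s) - σ s (y' s)) g) := by
  have hβ₀ : 0 ≤ β := (hα.trans hβ).le
  have hsub : uIcc 0 t ⊆ uIcc 0 T := uIcc_subset_uIcc_left (Icc_subset_uIcc ht)
  rw [vecStieltjes_sub hα hα' (hσ.memW_comp hβ₀ hβ hz.memW_driver)
      (hσ.memW_comp hβ₀ hβ hz'.memW_driver) hg ht,
    intervalIntegral.integral_sub ((hz.intervalIntegrable hT hα hα'.le hb).mono_set hsub)
      ((hz'.intervalIntegrable hT hα hα'.le hb).mono_set hsub),
    hz.eq_add_integral t ht, hz'.eq_add_integral t ht]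
  abel

lemma IsDrivenBy.exists_incrementBound_sub (hT : 0 ≤ T) (hα : 0 < α) (hα' : α < 1) (hδ : 0 ≤ δ)
    (hβ : α < β) (hl : α < l * δ) (hσ : HypH1 T β δ σ) (hb : HypH2' T (1 / α) b)
    (hg : MemWT α T g) (hN : N ≠ ∞) (hH : H ≠ ∞) :
    ∃ C ≠ ∞, ∀ x₀ x₀' y y' z z', IsDrivenBy α T b σ g x₀ y z → IsDrivenBy α T b σ g x₀' y' z' →
      (∀ u ∈ Icc 0 T, ‖y u‖ₑ ≤ N) → (∀ u ∈ Icc 0 T, ‖y' u‖ₑ ≤ N) →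
      (∀ u ∈ Icc 0 T, ‖z u‖ₑ ≤ N) → (∀ u ∈ Icc 0 T, ‖z' u‖ₑ ≤ N) →
      HolderBound l 0 T H y → HolderBound l 0 T H y' →
      IncrementBound α T 0 C (fun u => wPt α 0 (fun s => y s - y' s) u ⊔ ‖z u - z' u‖ₑ)
        (fun t => z t - z' t) := by
  have hβ₀ : 0 ≤ β := (hα.trans hβ).le
  obtain ⟨K, hK, hle⟩ := hσ.exists_wPt_comp_sub_le hδ hβ hl hN hH
  obtain ⟨L, hL, hlip⟩ := hb.exists_enorm_sub_le hN
  have hleft : leftBound α T ≠ ∞ := leftBound_ne_top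
  have hweyl : weylBound α (wTNorm α T g) ≠ ∞ := weylBound_ne_top hg.2.ne
  have hTα : epow T α ≠ ∞ := epow_ne_top
  refine ⟨L * epow T α + d * (m * (leftBound α T * weylBound α (wTNorm α T g))) * K,
    by finiteness, fun x₀ x₀' y y' z z' hz hz' hyN hy'N hzN hz'N hyH hy'H => ?_⟩
  set Ψ : ℝ → ℝ≥0∞ := fun u => wPt α 0 (fun s => y s - y' s) u ⊔ ‖z u - z' u‖ₑ
  have hdrift := incrementBound_intervalIntegral (q := (0 : ℝ → ℝ)) (Ψ := Ψ) hα hα'.le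
    aestronglyMeasurable_zero hL ((hz.intervalIntegrable hT hα hα'.le hb).sub
      (hz'.intervalIntegrable hT hα hα'.le hb)) fun u hu =>
      ((hlip u hu _ _ (hzN u hu) (hz'N u hu)).trans (mul_le_mul_right le_sup_right L)).trans
        le_add_self
  have hnoise := (incrementBound_vecStieltjes hα hα'
    ((hσ.memW_comp hβ₀ hβ hz.memW_driver).sub (hσ.memW_comp hβ₀ hβ hz'.memW_driver)) hg).mono
      (Ψ' := Ψ) hK fun u hu =>
      (hle y y' hyN hy'N hyH hy'H u hu).trans (mul_le_mul_right le_sup_left K)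
  have hsum := hdrift.add hnoise
  rw [eLpNorm_zero, zero_add] at hsum
  exact hsum.of_eq_const_add fun t ht => hz.sub_eq hT hα hα' hβ hσ hb hg hz' ht

end DrivenSolutions

section DelayLimit

variable {d m : ℕ} {T α β δ θ l r r₀ : ℝ} {W K N H : ℝ≥0∞}
  {b : ℝ → EuclideanSpace ℝ (Fin d) → EuclideanSpace ℝ (Fin d)}
  {σ : ℝ → EuclideanSpace ℝ (Fin d) → EuclideanSpace ℝ (Fin d × Fin m)}
  {g : ℝ → EuclideanSpace ℝ (Fin m)} {η z : ℝ → EuclideanSpace ℝ (Fin d)}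

lemma IsDrivenBy.exists_wPt_le (hT : 0 ≤ T) (hα : 0 < α) (hα' : α < 1 / 2) (hβ : α < β)
    (hσ : HypH1 T β δ σ) (hb : HypH2' T (1 / α) b) (hg : MemWT α T g) (hW : W ≠ ∞) :
    ∃ K ≠ ∞, ∀ r x₀ z, 0 ≤ r → MemW α (-r) T z →
      IsDrivenBy α T b σ g x₀ (fun s => z (s - r)) z →
      (∀ v ∈ Icc (-r) 0, wPt α (-r) z v ≤ W) → ∀ v ∈ Icc (-r) T, wPt α (-r) z v ≤ K := by
  obtain ⟨c, hc, C, hC, hincr⟩ :=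
    IsDrivenBy.exists_incrementBound hT hα (by linarith) hβ hσ hb hg
  obtain ⟨G, hG, hgronwall⟩ := IncrementBound.exists_gronwall (E := EuclideanSpace ℝ (Fin d))
    hα hα' T hC (A := 1 + ENNReal.ofReal α⁻¹) (by finiteness)
  refine ⟨W + G * (1 + W + W + c), by finiteness, fun r x₀ z hr hz hdriven hhistory v hv => ?_⟩
  rcases le_total v 0 with hv0 | hv0
  · exact (hhistory v ⟨hv.1, hv0⟩).trans le_self_add
  set φ : ℝ → ℝ≥0∞ := fun v => 1 + W + wPt α (-r) z v
  have hle_sup : ∀ {u v}, v ∈ Icc 0 u → φ v ≤ ⨆ v ∈ Icc 0 u, φ v := fun {u v} hv =>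
    le_iSup₂ (f := fun v (_ : v ∈ Icc 0 u) => φ v) v hv
  have hbdd : (⨆ t ∈ Icc 0 T, φ t) ≠ ∞ :=
    ne_top_of_le_ne_top (b := 1 + W + wNorm α (-r) T z) (by finiteness [hz.2.ne])
      (iSup₂_le fun t ht => add_le_add le_rfl
        (wPt_le_wNorm ⟨(neg_nonpos.2 hr).trans ht.1, ht.2⟩))
  have hφ : ∀ t ∈ Icc 0 T, φ t ≤ 1 + W + W + (1 + ENNReal.ofReal α⁻¹) * startNorm α z t :=
    fun t ht => by
      rw [add_assoc _ W (_ * _)]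
      exact add_le_add le_rfl ((wPt_le_wPt_zero_add_startNorm hα (neg_nonpos.2 hr) ht.1).trans
        (add_le_add (hhistory 0 ⟨neg_nonpos.2 hr, le_rfl⟩) le_rfl))
  have hΨ : ∀ u ∈ Icc 0 T, (1 + wPt α 0 (fun s => z (s - r)) u) ⊔ ‖z u‖ₑ ≤
      ⨆ v ∈ Icc 0 u, φ v := fun u hu => by
    refine sup_le ?_ ((enorm_le_wPt.trans le_add_self).trans (hle_sup ⟨hu.1, le_rfl⟩))
    rw [wPt_shift]
    rcases le_total (u - r) 0 with h | h
    · exact ((add_le_add le_rfl (hhistory _ ⟨by linarith [hu.1], h⟩)).trans le_self_add).trans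
        (hle_sup ⟨le_rfl, hu.1⟩)
    · exact (add_le_add le_self_add le_rfl).trans (hle_sup ⟨h, by linarith⟩)
  have hmeas : MeasOn 0 T (fun u => (1 + wPt α 0 (fun s => z (s - r)) u) ⊔ ‖z u‖ₑ) :=
    (Measurable.const_add hdriven.memW_driver.1.wPt 1).sup (Measurable.enorm hdriven.memW.1)
  calc wPt α (-r) z v ≤ φ v := le_add_self
    _ ≤ G * (1 + W + W + c) :=
        hgronwall c _ _ φ z hmeas (hincr x₀ _ z hdriven) hbdd hΨ hφ v ⟨hv0, hv.2⟩
    _ ≤ _ := le_add_self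

lemma IsDrivenBy.exists_holderBound (hT : 0 ≤ T) (hα : 0 < α) (hα' : α < 1) (hβ : α < β)
    (hσ : HypH1 T β δ σ) (hb : HypH2' T (1 / α) b) (hg : MemWT α T g) (hK : K ≠ ∞) :
    ∃ H ≠ ∞, ∀ x₀ y z, IsDrivenBy α T b σ g x₀ y z → (∀ u ∈ Icc 0 T, wPt α 0 y u ≤ K) →
      (∀ u ∈ Icc 0 T, ‖z u‖ₑ ≤ K) → HolderBound (1 - α) 0 T H z := by
  obtain ⟨c, hc, C, hC, hincr⟩ := IsDrivenBy.exists_incrementBound hT hα hα' hβ hσ hb hg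
  have hB : betaBound (1 - α) α ≠ ∞ := betaBound_ne_top
  refine ⟨c + C * (1 + K) * (ENNReal.ofReal (1 - α)⁻¹ + betaBound (1 - α) α), by finiteness,
    fun x₀ y z hz hy hzK => ?_⟩
  exact (hincr x₀ y z hz).holderBound hα hα' (by finiteness) fun u hu =>
    sup_le (add_le_add le_rfl (hy u hu)) ((hzK u hu).trans le_add_self)

lemma IsDelaySolution.wPt_history_le (hr : r ≤ r₀) (hz : IsDelaySolution α T r b σ g η z) {v : ℝ}
    (hv : v ∈ Icc (-r) 0) : wPt α (-r) z v ≤ wNorm α (-r₀) 0 η := calc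
  wPt α (-r) z v = wPt α (-r) η v :=
      wPt_eq_of_eqOn hv.1 fun s hs => hz.2.2 s ⟨hs.1, hs.2.trans hv.2⟩
  _ ≤ wPt α (-r₀) η v := wPt_le_wPt_of_le (neg_le_neg hr)
  _ ≤ _ := wPt_le_wNorm ⟨(neg_le_neg hr).trans hv.1, hv.2⟩

lemma IsDelaySolution.exists_wPt_le_and_holderBound (hT : 0 ≤ T) (hα : 0 < α) (hα' : α < 1 / 2)
    (hβ : α < β) (hσ : HypH1 T β δ σ) (hb : HypH2' T (1 / α) b) (hg : MemWT α T g)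
    (hη : MemW α (-r₀) 0 η) (hη' : MemHolder (1 - α) (-r₀) 0 η) :
    ∃ K ≠ ∞, ∃ H ≠ ∞, ∀ r ∈ Ioc 0 r₀, ∀ z, IsDelaySolution α T r b σ g η z →
      (∀ v ∈ Icc (-r) T, wPt α (-r) z v ≤ K) ∧ HolderBound (1 - α) (-r) T H z := by
  obtain ⟨K, hK, hle⟩ := IsDrivenBy.exists_wPt_le hT hα hα' hβ hσ hb hg hη.2.ne
  obtain ⟨H, hH, hholder⟩ := IsDrivenBy.exists_holderBound hT hα (by linarith) hβ hσ hb hg hK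
  refine ⟨K, hK, holderNorm (1 - α) (-r₀) 0 η + H, by finiteness [hη'.ne],
    fun r hr z hz => ?_⟩
  have hr' : -r ≤ 0 := neg_nonpos.2 hr.1.le
  have hzK := hle r (η 0) z hr.1.le hz.1 (hz.isDrivenBy hr.1.le) fun v hv =>
    hz.wPt_history_le hr.2 hv
  refine ⟨hzK, HolderBound.union (b := 0) (by linarith) ?_ ?_⟩
  · exact ((holderBound_holderNorm η).mono (neg_le_neg hr.2) le_rfl le_rfl).congr hz.2.2
  · refine hholder (η 0) _ z (hz.isDrivenBy hr.1.le) (fun u hu => ?_)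
      fun u hu => enorm_le_wPt.trans (hzK u ⟨hr'.trans hu.1, hu.2⟩)
    rw [wPt_shift]
    exact hzK _ ⟨by linarith [hu.1], by linarith [hu.2, hr.1]⟩

lemma IsDrivenBy.exists_wPt_sub_le (hT : 0 ≤ T) (hα : 0 < α) (hα' : α < 1 / 2) (hδ : 0 ≤ δ)
    (hβ : α < β) (hl : α < l * δ) (hσ : HypH1 T β δ σ) (hb : HypH2' T (1 / α) b)
    (hg : MemWT α T g) (hN : N ≠ ∞) (hH : H ≠ ∞) :
    ∃ G ≠ ∞, ∀ (x₀ : EuclideanSpace ℝ (Fin d)) (x y z : ℝ → EuclideanSpace ℝ (Fin d)) (ε : ℝ≥0∞),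
      IsDrivenBy α T b σ g x₀ x x → IsDrivenBy α T b σ g x₀ y z →
      (∀ u ∈ Icc 0 T, ‖x u‖ₑ ≤ N) → (∀ u ∈ Icc 0 T, ‖y u‖ₑ ≤ N) → (∀ u ∈ Icc 0 T, ‖z u‖ₑ ≤ N) →
      HolderBound l 0 T H x → HolderBound l 0 T H y → ε ≠ ∞ →
      (∀ u ∈ Icc 0 T, wPt α 0 (fun s => z s - y s) u ≤ ε) →
      ∀ t ∈ Icc 0 T, wPt α 0 (fun s => x s - z s) t ≤ G * ε := by
  obtain ⟨C, hC, hincr⟩ :=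
    IsDrivenBy.exists_incrementBound_sub hT hα (by linarith) hδ hβ hl hσ hb hg hN hH
  obtain ⟨G, hG, hgronwall⟩ := IncrementBound.exists_gronwall (E := EuclideanSpace ℝ (Fin d))
    hα hα' T hC (A := 1) ENNReal.one_ne_top
  refine ⟨G, hG, fun x₀ x y z ε hx hz hxN hyN hzN hxH hyH hε hzy t ht => ?_⟩
  set h := fun s => x s - z s
  have hh : MemW α 0 T h := hx.memW.sub hz.memW
  have h0 : h 0 = 0 := by
    simp only [h, hx.eq_add_integral 0 ⟨le_rfl, hT⟩, hz.eq_add_integral 0 ⟨le_rfl, hT⟩,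
      intervalIntegral.integral_same, vecStieltjes_zero, sub_self]
  have hstart : ∀ u, wPt α 0 h u ≤ startNorm α h u := fun u => by
    rw [wPt, startNorm, h0, sub_zero]
    exact add_le_add le_self_add le_rfl
  have hbdd : (⨆ u ∈ Icc 0 T, (wPt α 0 h u + ε)) ≠ ∞ :=
    ne_top_of_le_ne_top (b := wNorm α 0 T h + ε) (by finiteness [hh.2.ne])
      (iSup₂_le fun u hu => add_le_add (wPt_le_wNorm hu) le_rfl)
  have hxy : ∀ u ∈ Icc 0 T, wPt α 0 (fun s => x s - y s) u ≤ wPt α 0 h u + ε := fun u hu => by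
    have hadd := wPt_add_le (f' := fun s => z s - y s) (α := α) hh.1 hu
    simp only [h, sub_add_sub_cancel] at hadd
    exact hadd.trans (add_le_add le_rfl (hzy u hu))
  have hmeas : MeasOn 0 T fun u => wPt α 0 (fun s => x s - y s) u ⊔ ‖x u - z u‖ₑ :=
    Measurable.sup (hx.memW.sub hz.memW_driver).1.wPt (Measurable.enorm hh.1)
  have hle := hgronwall 0 ε _ (fun u => wPt α 0 h u + ε) h hmeas
    (hincr x₀ x₀ x y x z hx hz hxN hyN hxN hzN hxH hyH) hbdd
    (fun u hu => (sup_le (hxy u hu) (enorm_le_wPt.trans le_self_add)).trans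
      (le_iSup₂ (f := fun v (_ : v ∈ Icc 0 u) => wPt α 0 h v + ε) u ⟨hu.1, le_rfl⟩))
    (fun u _ => by
      rw [one_mul, add_comm]
      exact add_le_add le_rfl (hstart u)) t ht
  rw [add_zero] at hle
  exact le_self_add.trans hle

lemma IsSolution.exists_wNorm_sub_delay_le (hT : 0 ≤ T) (hα : 0 < α) (hαθ : α < θ)
    (hθ : θ ≤ 1 - α) (hδ : 0 ≤ δ) (hβ : α < β) (hκ : α < (1 - α) * δ) (hσ : HypH1 T β δ σ)
    (hb : HypH2' T (1 / α) b) (hg : MemWT α T g) (hη : MemW α (-r₀) 0 η)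
    (hη' : MemHolder (1 - α) (-r₀) 0 η) {x : ℝ → EuclideanSpace ℝ (Fin d)}
    (hx : IsSolution α T b σ g (η 0) x) :
    ∃ K ≠ ∞, ∀ r ∈ Ioc 0 r₀, ∀ z, IsDelaySolution α T r b σ g η z →
      wNorm α 0 T (fun t => x t - z t) ≤ K * epow r (1 - α - θ) := by
  have hα' : α < 1 / 2 := by linarith
  have hx' := hx.isDrivenBy
  obtain ⟨Kz, hKz, Hz, hHz, hdelay⟩ :=
    IsDelaySolution.exists_wPt_le_and_holderBound hT hα hα' hβ hσ hb hg hη hη'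
  obtain ⟨Hx, hHx, hholder⟩ :=
    IsDrivenBy.exists_holderBound hT hα (by linarith) hβ hσ hb hg hx.1.2.ne
  set N := wNorm α 0 T x + Kz
  have hN : N ≠ ∞ := by finiteness [hx.1.2.ne]
  have hxN : ∀ u ∈ Icc 0 T, ‖x u‖ₑ ≤ wNorm α 0 T x := fun u hu =>
    enorm_le_wPt.trans (wPt_le_wNorm hu)
  have hxH := hholder (η 0) x x hx' (fun u hu => wPt_le_wNorm hu) hxN
  obtain ⟨G, hG, hsub⟩ := IsDrivenBy.exists_wPt_sub_le (H := Hx + Hz) hT hα hα' hδ hβ hκ hσ hb hg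
    hN (by finiteness)
  set D := Hz * epow r₀ θ + 2 * Hz * incIntBound α T θ
  have hD : D ≠ ∞ := by
    finiteness [epow_ne_top (x := r₀) (p := θ), incIntBound_ne_top α T θ]
  refine ⟨G * D, by finiteness, fun r hr z hz => ?_⟩
  obtain ⟨hzK, hzH⟩ := hdelay r hr z hz
  have hzN : ∀ u ∈ Icc (-r) T, ‖z u‖ₑ ≤ N := fun u hu =>
    (enorm_le_wPt.trans (hzK u hu)).trans le_add_self
  rw [wNorm_eq_iSup_wPt, mul_assoc]
  refine iSup₂_le (hsub (η 0) x (fun s => z (s - r)) z _ hx' (hz.isDrivenBy hr.1.le)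
    (fun u hu => (hxN u hu).trans le_self_add)
    (fun u hu => hzN _ ⟨by linarith [hu.1], by linarith [hu.2, hr.1]⟩)
    (fun u hu => hzN u ⟨by linarith [hu.1, hr.1], hu.2⟩)
    (hxH.mono le_rfl le_rfl le_self_add) (hzH.shift.mono (by linarith) (by linarith [hr.1])
      le_add_self) (by finiteness [epow_ne_top (x := r) (p := 1 - α - θ)])
    fun u hu => hzH.wPt_delay_le hHz hr (hα.trans hαθ).le hαθ hθ hu)

end DelayLimit

end DelayEq

end

theorem theorem4p3 {d m : ℕ} (T α β δ r₀ : ℝ) (hT : 0 < T)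
    (hβ : 0 < β) (hβ' : β ≤ 1) (hδ : 0 < δ) (hδ' : δ ≤ 1)
    (hα : 0 < α) (hα' : α < min (1 / 2) (min β (δ / (1 + δ)))) (hr₀ : 0 < r₀)
    (b : ℝ → EuclideanSpace ℝ (Fin d) → EuclideanSpace ℝ (Fin d))
    (σ : ℝ → EuclideanSpace ℝ (Fin d) → EuclideanSpace ℝ (Fin d × Fin m))
    (g : ℝ → EuclideanSpace ℝ (Fin m)) (η : ℝ → EuclideanSpace ℝ (Fin d))
    (hσ : DelayEq.HypH1 T β δ σ) (hb : DelayEq.HypH2' T (1 / α) b)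
    (hg : DelayEq.MemWT α T g)
    (hη : DelayEq.MemW α (-r₀) 0 η) (hη' : DelayEq.MemHolder (1 - α) (-r₀) 0 η)
    (x : ℝ → EuclideanSpace ℝ (Fin d))
    (hx : DelayEq.IsSolution α T b σ g (η 0) x)
    (xr : ℝ → ℝ → EuclideanSpace ℝ (Fin d))
    (hxr : ∀ r ∈ Set.Ioc 0 r₀, DelayEq.IsDelaySolution α T r b σ g η (xr r)) :
    Filter.Tendsto (fun r => DelayEq.wNorm α 0 T (fun t => x t - xr r t))
      (nhdsWithin 0 (Set.Ioi 0)) (nhds 0) := by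
  obtain ⟨hα₂, hα'⟩ := lt_min_iff.1 hα'
  obtain ⟨hαβ, hαδ⟩ := lt_min_iff.1 hα'
  have hκ : α < (1 - α) * δ := by
    rw [lt_div_iff₀ (by linarith)] at hαδ
    linarith
  obtain ⟨K, hK, hle⟩ := DelayEq.IsSolution.exists_wNorm_sub_delay_le hT.le hα hα₂
    (by linarith) hδ.le hαβ hκ hσ hb hg hη hη' hx
  have hlim : Tendsto (fun r => K * DelayEq.epow r (1 - α - 1 / 2)) (𝓝[>] 0) (𝓝 0) := by
    simpa using ENNReal.Tendsto.const_mul (DelayEq.tendsto_epow_zero (by linarith)) (Or.inr hK)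
  refine tendsto_of_tendsto_of_tendsto_of_le_of_le' tendsto_const_nhds hlim
    (Eventually.of_forall fun _ => zero_le) ?_
  filter_upwards [Ioc_mem_nhdsGT hr₀] with r hr
  exact hle r hr (xr r) (hxr r hr)
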